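/- All graphs are finite and simple. A path-decomposition of a graph $H=(V,E)$ is a sequence $X_1,\dots,X_r$ of subsets of $V$ (bags) such that every vertex lies in some bag, both ends of every edge lie together in some bag, and $X_i\cap X_k\subseteq X_j$ whenever $i<j<k$. Its width is $\max_i|X_i|-1$, and the pathwidth of $H$ is the least width of a path-decomposition of $H$. A homeomorphic embedding of a graph $G$ in $H$ is an injection $\varphi:V(G)\to V(H)$ together with a path of $H$ from $\varphi(u)$ to $\varphi(v)$ for every edge $uv$ of $G$, where the paths are disjoint except at the images of common ends, and contain no images of other vertices. Let $B_h$ be the complete binary tree with $h$ levels and $2^h-1$ vertices, let $h(t)$ be the least $h$ such that $B_h$ has pathwidth greater than $t$, and let $f(t)=2^{h(t)}-1$. For every fixed integer $t\ge 0$ we have $f(t)\le 2^{2t+2}-1$, and there are a program for the unit-cost random access machine (with addition, subtraction, comparison and indirect addressing) and a constant $C$, depending only on $t$, such that the following holds. Given any graph $H$ on $n$ vertices with $m$ edges, by its adjacency lists stored consecutively in an array together with the array of their starting positions, the program halts after at most $C(n+1)$ steps, never writes a number larger than $C(n+m+1)$, and has one of the following results: 1. it reports that $H$ has more than $t\cdot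 n$ edges, and this is the case and the pathwidth of $H$ is greater than $t$; 2. it outputs a homeomorphic embedding of $B_{h(t)}$ in $H$ (the image of the root and the path for each tree edge), and the pathwidth of $H$ is greater than $t$; 3. it outputs a path-decomposition of $H$ of width at most $f(t)-1\le 2^{2t+2}-2=2^{O(t)}$. -/

import Mathlib

namespace PathwidthApprox

/-! ### Path-decompositions and pathwidth -/

section Pathwidth

variable {V : Type*}

/-- The sequence of bags `X` is a path-decomposition of the graph `G`. -/
structure IsPathDecomposition (G : SimpleGraph V) (X : List (Finset V)) : Prop where
  cover : ∀ v : V, ∃ B ∈ X, v ∈ B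
  edge : ∀ u v : V, G.Adj u v → ∃ B ∈ X, u ∈ B ∧ v ∈ B
  interp : ∀ (i j k : ℕ) (hij : i < j) (hjk : j < k) (hk : k < X.length) (v : V),
    v ∈ X[i] → v ∈ X[k] → v ∈ X[j]

/-- The width of a sequence of bags: the largest size of a bag, minus one.
(The subtraction truncates only if all bags are empty, i.e. for the graph without vertices.) -/
def width (X : List (Finset V)) : ℕ := (X.map Finset.card).foldr max 0 - 1

/-- The pathwidth of a (finite) graph: the least width of a path-decomposition. -/
noncomputable def pathwidth (G : SimpleGraph V) : ℕ :=
  sInf {w | ∃ X : List (Finset V), IsPathDecomposition G X ∧ width X = w}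

end Pathwidth

/-! ### Homeomorphic embeddings and complete binary trees -/

/-- A homeomorphic embedding of `G` into `H` (equivalently, a subgraph of `H` that is a subdivision
of `G`): an injection on vertices, together with paths of `H` for the edges of `G`. The path of an
edge avoids the images of all vertices other than its two ends, and the paths of two different edges
meet at most in the image of a common end. -/
structure HomeoEmbedding {V W : Type*} (G : SimpleGraph V) (H : SimpleGraph W) where
  toFun : V → W
  injective : Function.Injective toFun
  path : ∀ u v : V, G.Adj u v → H.Walk (toFun u) (toFun v)
  isPath : ∀ (u v : V) (h : G.Adj u v), (path u v h).IsPath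
  path_symm : ∀ (u v : V) (h : G.Adj u v), path v u h.symm = (path u v h).reverse
  avoid : ∀ (u v : V) (h : G.Adj u v) (a : V), toFun a ∈ (path u v h).support → a = u ∨ a = v
  disjoint : ∀ (u v : V) (h : G.Adj u v) (x y : V) (h' : G.Adj x y), s(u, v) ≠ s(x, y) →
    ∀ w : W, w ∈ (path u v h).support → w ∈ (path x y h').support →
      ∃ a : V, a ∈ s(u, v) ∧ a ∈ s(x, y) ∧ toFun a = w

/-- The complete binary tree with `h` levels and `2 ^ h - 1` vertices, numbered level by level:
the root is `0`, and the children of `i` are `2 * i + 1` and `2 * i + 2`. -/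
def binaryTree (h : ℕ) : SimpleGraph (Fin (2 ^ h - 1)) :=
  SimpleGraph.fromRel fun i j => (j : ℕ) = 2 * i + 1 ∨ (j : ℕ) = 2 * i + 2

/-- The least height of a complete binary tree of pathwidth greater than `t`. -/
noncomputable def guestHeight (t : ℕ) : ℕ := sInf {h | t < pathwidth (binaryTree h)}

/-- The number of vertices of the smallest complete binary tree of pathwidth greater than `t`. -/
noncomputable def guestOrder (t : ℕ) : ℕ := 2 ^ guestHeight t - 1

/-! ### The machine: a unit-cost random access machine with bounded words -/

/-- The memory: registers, and finitely many (as far as a program can mention them) arrays that are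
addressed indirectly. All cells hold natural numbers. -/
structure Store where
  reg : ℕ → ℕ
  arr : ℕ → ℕ → ℕ

/-- The elementary instructions. Register and array names are fixed in the program text. -/
inductive Op where
  /-- `r := c` -/
  | const (r c : ℕ)
  /-- `r := a + b` -/
  | add (r a b : ℕ)
  /-- `r := a - b`, or `0` if `a < b` -/
  | sub (r a b : ℕ)
  /-- `r := A[i]` -/
  | load (r A i : ℕ)
  /-- `A[i] := a` -/
  | store (A i a : ℕ)

/-- The word that an instruction writes. -/
def Op.value (s : Store) : Op → ℕ
  | .const _ c => c
  | .add _ a b => s.reg a + s.reg b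
  | .sub _ a b => s.reg a - s.reg b
  | .load _ A i => s.arr A (s.reg i)
  | .store _ _ a => s.reg a

/-- The effect of an instruction on the memory. -/
def Op.run (s : Store) (o : Op) : Store :=
  match o with
  | .const r _ | .add r _ _ | .sub r _ _ | .load r _ _ =>
      { s with reg := Function.update s.reg r (o.value s) }
  | .store A i _ =>
      let a := Function.update (s.arr A) (s.reg i) (o.value s)
      { s with arr := Function.update s.arr A a }

/-- The tests compare two registers. -/
inductive Test where
  | lt (a b : ℕ)
  | eq (a b : ℕ)

/-- The outcome of a test. -/
def Test.holds (s : Store) : Test → Prop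
  | .lt a b => s.reg a < s.reg b
  | .eq a b => s.reg a = s.reg b

/-- Programs. -/
inductive Program where
  | skip
  | op (o : Op)
  | seq (p q : Program)
  | ite (b : Test) (p q : Program)
  | while (b : Test) (p : Program)

/-- `Exec W p s s' k`: on a machine whose words are the numbers up to `W`, the program `p` started
in the memory `s` halts in the memory `s'` after exactly `k` steps. Each elementary instruction and
each evaluation of a test is one step. A program that tries to write a larger number than `W` is
stuck: it has no execution. -/
inductive Exec (W : ℕ) : Program → Store → Store → ℕ → Prop where
  | skip (s : Store) : Exec W .skip s s 0
  | op (o : Op) (s : Store) (h : o.value s ≤ W) : Exec W (.op o) s (o.run s) 1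
  | seq {p q : Program} {s s' s'' : Store} {k l : ℕ} (hp : Exec W p s s' k)
      (hq : Exec W q s' s'' l) : Exec W (.seq p q) s s'' (k + l)
  | ite_true {b : Test} {p q : Program} {s s' : Store} {k : ℕ} (hb : b.holds s)
      (hp : Exec W p s s' k) : Exec W (.ite b p q) s s' (k + 1)
  | ite_false {b : Test} {p q : Program} {s s' : Store} {k : ℕ} (hb : ¬ b.holds s)
      (hq : Exec W q s s' k) : Exec W (.ite b p q) s s' (k + 1)
  | while_false {b : Test} {p : Program} {s : Store} (hb : ¬ b.holds s) :
      Exec W (.while b p) s s 1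
  | while_true {b : Test} {p : Program} {s s' s'' : Store} {k l : ℕ} (hb : b.holds s)
      (hp : Exec W p s s' k) (hw : Exec W (.while b p) s' s'' l) :
      Exec W (.while b p) s s'' (k + l + 1)

/-- The machine is deterministic: final memory and number of steps depend only on the program and
the initial memory. -/
theorem Exec.deterministic {W : ℕ} {p : Program} {s s₁ s₂ : Store} {k₁ k₂ : ℕ}
    (h₁ : Exec W p s s₁ k₁) (h₂ : Exec W p s s₂ k₂) : s₁ = s₂ ∧ k₁ = k₂ := by
  induction h₁ generalizing s₂ k₂ with
  | skip s => cases h₂; exact ⟨rfl, rfl⟩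
  | op o s h => cases h₂; exact ⟨rfl, rfl⟩
  | seq _ _ ihp ihq =>
    cases h₂ with
    | seq hp' hq' =>
      obtain ⟨rfl, rfl⟩ := ihp hp'
      obtain ⟨rfl, rfl⟩ := ihq hq'
      exact ⟨rfl, rfl⟩
  | ite_true hb _ ih =>
    cases h₂ with
    | ite_true _ h => obtain ⟨rfl, rfl⟩ := ih h; exact ⟨rfl, rfl⟩
    | ite_false hb' _ => exact absurd hb hb'
  | ite_false hb _ ih =>
    cases h₂ with
    | ite_true hb' _ => exact absurd hb' hb
    | ite_false _ h => obtain ⟨rfl, rfl⟩ := ih h; exact ⟨rfl, rfl⟩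
  | while_false hb =>
    cases h₂ with
    | while_false _ => exact ⟨rfl, rfl⟩
    | while_true hb' _ _ => exact absurd hb' hb
  | while_true hb _ _ ihp ihw =>
    cases h₂ with
    | while_false hb' => exact absurd hb hb'
    | while_true _ hp' hw' =>
      obtain ⟨rfl, rfl⟩ := ihp hp'
      obtain ⟨rfl, rfl⟩ := ihw hw'
      exact ⟨rfl, rfl⟩

/-! ### Input and output formats -/

/-- The list `l` enumerates the set `S` of vertices, each vertex once, in some order. -/
def Enumerates {n : ℕ} (l : List ℕ) (S : Set (Fin n)) : Prop :=
  l.Nodup ∧ ∀ x : ℕ, x ∈ l ↔ ∃ v : Fin n, v ∈ S ∧ (v : ℕ) = x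

/-- `L` consists of the adjacency lists of `H`, each in an arbitrary order. -/
def IsAdjacencyList {n : ℕ} (H : SimpleGraph (Fin n)) (L : List (List ℕ)) : Prop :=
  List.Forall₂ Enumerates L (List.ofFn fun v : Fin n => H.neighborSet v)

/-- The initial memory for a sequence of lists: register `0` holds the number of lists, array `1`
holds the lists one after the other, and entry `i` of array `0` is the position in array `1` at
which list `i` begins (with one more entry for the end of the last list). All other cells are
zero. -/
def inputStore (L : List (List ℕ)) : Store where
  reg r := if r = 0 then L.length else 0
  arr A i :=
    if A = 0 then (if i ≤ L.length then (L.take i).flatten.length else 0)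
    else if A = 1 then L.flatten.getD i 0
    else 0

/-- The memory `s` shows the sequence of lists `L` as output: in the format of the input, with the
number of lists in register `1`, their starting positions in array `2` and their entries in
array `3`. -/
def Outputs (s : Store) (L : List (List ℕ)) : Prop :=
  s.reg 1 = L.length ∧
  (∀ i ≤ L.length, s.arr 2 i = (L.take i).flatten.length) ∧
  ∀ (j : ℕ) (hj : j < L.flatten.length), s.arr 3 j = L.flatten[j]

/-- The lists `L` write out the sequence of bags `X`. -/
def WritesBags {n : ℕ} (L : List (List ℕ)) (X : List (Finset (Fin n))) : Prop :=
  List.Forall₂ (fun l B => Enumerates l (B : Set (Fin n))) L X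

/-- The lists `L` write out the homeomorphic embedding `E` of a complete binary tree: list `0` is
the image of the root, and for every other tree vertex `i` list `i` is the path in the host graph
from the image of the parent of `i` to the image of `i`. -/
def WritesEmbedding {n h : ℕ} {H : SimpleGraph (Fin n)} (L : List (List ℕ))
    (E : HomeoEmbedding (binaryTree h) H) : Prop :=
  L.length = 2 ^ h - 1 ∧
  (∀ r : Fin (2 ^ h - 1), (r : ℕ) = 0 → L[(r : ℕ)]? = some [(E.toFun r : ℕ)]) ∧
  ∀ (p i : Fin (2 ^ h - 1)) (hpi : (binaryTree h).Adj p i), p < i →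
    L[(i : ℕ)]? = some ((E.path p i hpi).support.map fun v => (v : ℕ))

end PathwidthApprox

namespace PathwidthApprox

/-! ### Pathwidth -/

section Pathwidth

variable {V W : Type*}

/-! The program tries to grow a subdivision of the heap-ordered tree with `N = guestOrder t`
positions inside `H`. An occupied position carries a token, a vertex of `H`, and a branch of the
search forest leading from it towards the token of the parent position. At the first empty position
`c` the token `x` of the parent position looks at its next neighbour, and an unvisited neighbour is
placed at `c`. Once `x` has run out of neighbours it is dropped: the subtree at the sibling of `c`
moves up into its place, and the old branch is appended to that of the new token. An empty root
position receives the next unvisited vertex. Every placement writes the set of current tokens as a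
bag.

A vertex holds a token during one interval of time, which gives the interpolation property. It is
dropped only after all its neighbours have been visited, so when the later end of an edge is placed,
the earlier end is still a token and both lie in the new bag. Hence, if every vertex gets visited,
the bags form a path-decomposition with at most `N` vertices per bag. If instead all positions
become occupied, tokens and branches form a subdivision of the tree, and contracting the branches
shows that `H` has pathwidth greater than `t`. The argument is carried by `State.Inv`, its
preservation under `place`, `advance` and `contract`, and `Inv.isPathDecomposition`,
`Inv.exists_homeoEmbedding` and `Inv.pathwidth_le`.

The bound on `guestOrder` holds because two more levels raise the pathwidth of a complete binary
tree (`pathwidth_binaryTree_lt`): three disjoint subtrees cannot each fill a bag.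

For the running time, `State.potential` is at most `3 * n + 2 * m` initially, and every step of the
main loop that does not end it lowers it at a cost depending only on `N`. The number of edges is
read off the input at once; if it exceeds `t * n`, the pathwidth is large
(`lt_pathwidth_of_lt_ncard_edgeSet`), and otherwise the potential is linear in `n`. `Represents`
ties states to memories, and loop-free pieces of the program are verified by weakest preconditions.
-/

theorem le_foldr_max {l : List ℕ} {a : ℕ} (h : a ∈ l) : a ≤ l.foldr max 0 := by
  induction l with
  | nil => simp at h
  | cons b l ih =>
    rcases List.mem_cons.1 h with rfl | h
    · simp
    · exact (ih h).trans (by simp)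

theorem foldr_max_le {l : List ℕ} {k : ℕ} (h : ∀ a ∈ l, a ≤ k) : l.foldr max 0 ≤ k := by
  induction l with
  | nil => simp
  | cons b l ih =>
    simp only [List.foldr_cons]
    exact max_le (h b (by simp)) (ih fun a ha => h a (by simp [ha]))

theorem card_le_width {X : List (Finset V)} {B : Finset V} (h : B ∈ X) :
    B.card ≤ width X + 1 := by
  have : B.card ≤ (X.map Finset.card).foldr max 0 :=
    le_foldr_max (List.mem_map_of_mem h)
  unfold width
  omega

theorem width_le {X : List (Finset V)} {k : ℕ} (h : ∀ B ∈ X, B.card ≤ k + 1) : width X ≤ k := by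
  have : (X.map Finset.card).foldr max 0 ≤ k + 1 := foldr_max_le fun a ha => by
    obtain ⟨B, hB, rfl⟩ := List.mem_map.1 ha
    exact h B hB
  unfold width
  omega

theorem pathwidth_le {G : SimpleGraph V} {X : List (Finset V)} (hX : IsPathDecomposition G X)
    {k : ℕ} (h : ∀ B ∈ X, B.card ≤ k + 1) : pathwidth G ≤ k := by
  have : pathwidth G ≤ width X := Nat.sInf_le ⟨X, hX, rfl⟩
  exact this.trans (width_le h)

theorem exists_isPathDecomposition_card_le [Finite V] (G : SimpleGraph V) :
    ∃ X, IsPathDecomposition G X ∧ ∀ B ∈ X, B.card ≤ pathwidth G + 1 := by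
  have := Fintype.ofFinite V
  have hne : {w | ∃ X : List (Finset V), IsPathDecomposition G X ∧ width X = w}.Nonempty :=
    ⟨_, [Finset.univ], ⟨by simp, by simp, fun i j k hij hjk hk => by simp at hk; omega⟩, rfl⟩
  obtain ⟨X, hX, hw⟩ := Nat.sInf_mem hne
  exact ⟨X, hX, fun B hB => (card_le_width hB).trans (by rw [hw]; rfl)⟩

theorem exists_card_lt_of_lt_pathwidth {G : SimpleGraph V} {X : List (Finset V)}
    (hX : IsPathDecomposition G X) {k : ℕ} (h : k < pathwidth G) : ∃ B ∈ X, k + 1 < B.card := by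
  by_contra! hc
  exact absurd (pathwidth_le hX hc) (by omega)

/-- `a` and `b` are joined by a walk of `G` inside `S`. -/
def Joined (G : SimpleGraph V) (S : Set V) (a b : V) : Prop :=
  ∃ w : G.Walk a b, ∀ x ∈ w.support, x ∈ S

namespace Joined

variable {G : SimpleGraph V} {S T : Set V} {a b c : V}

theorem refl (ha : a ∈ S) : Joined G S a a := ⟨.nil, by simpa⟩

theorem symm (h : Joined G S a b) : Joined G S b a := by
  obtain ⟨w, hw⟩ := h
  exact ⟨w.reverse, by simpa using hw⟩

theorem trans (h : Joined G S a b) (h' : Joined G S b c) : Joined G S a c := by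
  obtain ⟨w, hw⟩ := h
  obtain ⟨w', hw'⟩ := h'
  refine ⟨w.append w', fun x hx => ?_⟩
  rcases (SimpleGraph.Walk.mem_support_append_iff _ _).1 hx with h | h
  exacts [hw _ h, hw' _ h]

theorem adj (h : G.Adj a b) (ha : a ∈ S) (hb : b ∈ S) : Joined G S a b :=
  ⟨.cons h .nil, by simp [ha, hb]⟩

theorem mono (h : Joined G S a b) (hST : S ⊆ T) : Joined G T a b := by
  obtain ⟨w, hw⟩ := h
  exact ⟨w, fun x hx => hST (hw x hx)⟩

end Joined

/-! ### Bags met by connected sets; minors and edge counts. -/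

theorem IsPathDecomposition.interp_le {G : SimpleGraph V} {X : List (Finset V)}
    (hX : IsPathDecomposition G X) {i j k : ℕ} (hij : i ≤ j) (hjk : j ≤ k) (hk : k < X.length)
    {v : V} (hi : v ∈ X[i]) (hk' : v ∈ X[k]) : v ∈ X[j] := by
  rcases hij.eq_or_lt with rfl | hij
  · exact hi
  rcases hjk.eq_or_lt with rfl | hjk
  · exact hk'
  exact hX.interp i j k hij hjk hk v hi hk'

/-- Bags between two bags that meet a walk meet the walk. -/
theorem IsPathDecomposition.exists_mem_bag {G : SimpleGraph V} {X : List (Finset V)}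
    (hX : IsPathDecomposition G X) {a c : V} {S : Set V} (h : Joined G S a c) {i j k : ℕ}
    (hij : i ≤ j) (hjk : j ≤ k) (hk : k < X.length) (ha : a ∈ X[i]) (hc : c ∈ X[k]) :
    ∃ x ∈ S, x ∈ X[j] := by
  obtain ⟨w, hw⟩ := h
  induction w generalizing i with
  | nil => exact ⟨_, hw _ (by simp), hX.interp_le hij hjk hk ha hc⟩
  | @cons a b c hab w ih =>
    obtain ⟨B, hB, haB, hbB⟩ := hX.edge a b hab
    obtain ⟨l, hl, rfl⟩ := List.getElem_of_mem hB
    -- If the bag `l` of the first edge is not beyond `j`, the rest of the walk still has to pass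
    -- `j`; otherwise `a` lies in bags on both sides of `j`.
    rcases le_total l j with hlj | hlj
    · exact ih hlj hbB hc fun x hx => hw x (by simp [hx])
    · exact ⟨a, hw _ (by simp), hX.interp_le hij hlj hl ha haB⟩

/-- The image of a path-decomposition under a partial map with connected fibres that covers all
vertices and edges. -/
theorem IsPathDecomposition.map_minor {G : SimpleGraph V} {H : SimpleGraph W}
    {X : List (Finset W)} (hX : IsPathDecomposition H X) (f : W → Option V)
    (hconn : ∀ v a b, f a = some v → f b = some v → Joined H {x | f x = some v} a b)
    (hsurj : ∀ v, ∃ a, f a = some v)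
    (hadj : ∀ u v, G.Adj u v → ∃ a b, f a = some u ∧ f b = some v ∧ H.Adj a b) :
    ∃ Y : List (Finset V), IsPathDecomposition G Y ∧
      ∀ B ∈ Y, ∃ A ∈ X, B.card ≤ A.card ∧ ∀ v ∈ B, ∃ a ∈ A, f a = some v := by
  classical
  have hmem : ∀ (A : Finset W) (v : V), v ∈ (A.image f).eraseNone ↔ ∃ a ∈ A, f a = some v := by
    simp
  refine ⟨X.map fun A => (A.image f).eraseNone, ⟨?_, ?_, ?_⟩, ?_⟩
  · intro v
    obtain ⟨a, ha⟩ := hsurj v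
    obtain ⟨A, hA, haA⟩ := hX.cover a
    exact ⟨_, List.mem_map_of_mem hA, (hmem A v).2 ⟨a, haA, ha⟩⟩
  · intro u v huv
    obtain ⟨a, b, ha, hb, hab⟩ := hadj u v huv
    obtain ⟨A, hA, haA, hbA⟩ := hX.edge a b hab
    exact ⟨_, List.mem_map_of_mem hA, (hmem A u).2 ⟨a, haA, ha⟩, (hmem A v).2 ⟨b, hbA, hb⟩⟩
  · intro i j k hij hjk hk v hi hk'
    simp only [List.length_map] at hk
    simp only [List.getElem_map] at hi hk' ⊢
    rw [hmem] at hi hk' ⊢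
    obtain ⟨a, haA, ha⟩ := hi
    obtain ⟨b, hbA, hb⟩ := hk'
    obtain ⟨x, hx, hxj⟩ := hX.exists_mem_bag (hconn v a b ha hb) hij.le hjk.le hk haA hbA
    exact ⟨x, hxj, hx⟩
  · intro B hB
    obtain ⟨A, hA, rfl⟩ := List.mem_map.1 hB
    refine ⟨A, hA, ?_, fun v hv => (hmem A v).1 hv⟩
    calc _ ≤ (A.image f).card := by
          rw [← Finset.card_map Function.Embedding.some]
          exact Finset.card_le_card (by rw [Finset.map_some_eraseNone]; exact Finset.erase_subset _ _)
      _ ≤ A.card := Finset.card_image_le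

theorem pathwidth_le_of_minor [Finite W] {G : SimpleGraph V} {H : SimpleGraph W}
    (f : W → Option V)
    (hconn : ∀ v a b, f a = some v → f b = some v → Joined H {x | f x = some v} a b)
    (hsurj : ∀ v, ∃ a, f a = some v)
    (hadj : ∀ u v, G.Adj u v → ∃ a b, f a = some u ∧ f b = some v ∧ H.Adj a b) :
    pathwidth G ≤ pathwidth H := by
  obtain ⟨X, hX, hc⟩ := exists_isPathDecomposition_card_le H
  obtain ⟨Y, hY, h⟩ := hX.map_minor f hconn hsurj hadj
  refine pathwidth_le hY fun B hB => ?_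
  obtain ⟨A, hA, hAB, -⟩ := h B hB
  exact hAB.trans (hc A hA)

/-- A graph of pathwidth at most `t` has at most `t` edges per vertex. -/
theorem lt_pathwidth_of_lt_ncard_edgeSet {n t : ℕ} (H : SimpleGraph (Fin n))
    (h : t * n < H.edgeSet.ncard) : t < pathwidth H := by
  classical
  by_contra! ht
  obtain ⟨X, hX, hc⟩ := exists_isPathDecomposition_card_le H
  have hlast : ∀ v : Fin n, ∃ i, ∃ hi : i < X.length, v ∈ X[i] ∧
      ∀ j, ∀ hj : j < X.length, v ∈ X[j] → j ≤ i := by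
    intro v
    obtain ⟨B, hB, hv⟩ := hX.cover v
    obtain ⟨l, hl, rfl⟩ := List.getElem_of_mem hB
    have := Nat.findGreatest_spec (P := fun i => ∃ hi : i < X.length, v ∈ X[i]) hl.le ⟨hl, hv⟩
    refine ⟨_, this.1, this.2, fun j hj hvj => Nat.le_findGreatest hj.le ⟨hj, hvj⟩⟩
  choose last hlt hmem hmax using hlast
  -- Each edge is charged to the end whose last bag comes first. That bag also contains the other
  -- end, so a vertex is charged at most `t` times.
  let out : Fin n → Finset (Sym2 (Fin n)) := fun v => ((X[last v]'(hlt v)).erase v).image fun w => s(v, w)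
  have hout : ∀ v, (out v).card ≤ t := by
    intro v
    refine Finset.card_image_le.trans ?_
    rw [Finset.card_erase_of_mem (hmem v)]
    have := hc _ (List.getElem_mem (hlt v))
    omega
  have key : ∀ u v, H.Adj u v → last u ≤ last v → s(u, v) ∈ out u := by
    intro u v huv hle
    refine Finset.mem_image.2 ⟨v, Finset.mem_erase.2 ⟨huv.ne', ?_⟩, rfl⟩
    obtain ⟨B, hB, hu, hv⟩ := hX.edge u v huv
    obtain ⟨l, hl, rfl⟩ := List.getElem_of_mem hB
    exact hX.interp_le (hmax u l hl hu) hle (hlt v) hv (hmem v)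
  have hsub : H.edgeSet ⊆ ↑(Finset.univ.biUnion out) := by
    intro e he
    induction e with
    | h u v =>
      have huv : H.Adj u v := he
      simp only [Finset.coe_biUnion, Set.mem_iUnion, Finset.mem_coe]
      rcases le_total (last u) (last v) with hle | hle
      · exact ⟨u, by simp, key u v huv hle⟩
      · exact ⟨v, by simp, by rw [Sym2.eq_swap]; exact key v u huv.symm hle⟩
  have h1 := Set.ncard_le_ncard hsub (Finset.finite_toSet _)
  rw [Set.ncard_coe_finset] at h1
  have h2 : (Finset.univ.biUnion out).card ≤ Finset.card (Finset.univ : Finset (Fin n)) * t :=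
    Finset.card_biUnion_le_card_mul _ _ _ fun v _ => hout v
  simp only [Finset.card_univ, Fintype.card_fin] at h2
  have := mul_comm n t
  omega

/-! ### Three sets that cannot all contain a bag. -/

/-- A walk between the outer bags must meet the middle bag, but it can be chosen to avoid the set
containing that bag. -/
theorem not_bag_subset_of_joined_compl {G : SimpleGraph V} {X : List (Finset V)}
    (hX : IsPathDecomposition G X) {S S' S'' : Set V} {i j k : ℕ} {hi : i < X.length}
    {hj : j < X.length} {hk : k < X.length} (h₁ : X[i].Nonempty ∧ ↑X[i] ⊆ S)
    (h₂ : X[j].Nonempty ∧ ↑X[j] ⊆ S') (h₃ : X[k].Nonempty ∧ ↑X[k] ⊆ S'')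
    (hJ : ∀ a ∈ S, ∀ b ∈ S'', Joined G S'ᶜ a b) (hij : i ≤ j) (hjk : j ≤ k) : False := by
  obtain ⟨a, ha⟩ := h₁.1
  obtain ⟨b, hb⟩ := h₃.1
  obtain ⟨x, hx, hxj⟩ := hX.exists_mem_bag (hJ a (h₁.2 ha) b (h₃.2 hb)) hij hjk hk ha hb
  exact hx (h₂.2 hxj)

/-- Three sets, any two of them joined outside the third, cannot all contain a bag. -/
theorem not_three_bags {G : SimpleGraph V} {X : List (Finset V)}
    (hX : IsPathDecomposition G X) {S S' S'' : Set V}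
    (h₁ : ∃ B ∈ X, B.Nonempty ∧ ↑B ⊆ S) (h₂ : ∃ B ∈ X, B.Nonempty ∧ ↑B ⊆ S')
    (h₃ : ∃ B ∈ X, B.Nonempty ∧ ↑B ⊆ S'')
    (hJ₁ : ∀ a ∈ S', ∀ b ∈ S'', Joined G Sᶜ a b)
    (hJ₂ : ∀ a ∈ S, ∀ b ∈ S'', Joined G S'ᶜ a b)
    (hJ₃ : ∀ a ∈ S, ∀ b ∈ S', Joined G S''ᶜ a b) : False := by
  obtain ⟨_, hB, h₁⟩ := h₁
  obtain ⟨i, hi, rfl⟩ := List.getElem_of_mem hB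
  obtain ⟨_, hB, h₂⟩ := h₂
  obtain ⟨j, hj, rfl⟩ := List.getElem_of_mem hB
  obtain ⟨_, hB, h₃⟩ := h₃
  obtain ⟨k, hk, rfl⟩ := List.getElem_of_mem hB
  have hJ₁' : ∀ a ∈ S'', ∀ b ∈ S', Joined G Sᶜ a b := fun a ha b hb => (hJ₁ b hb a ha).symm
  have hJ₂' : ∀ a ∈ S'', ∀ b ∈ S, Joined G S'ᶜ a b := fun a ha b hb => (hJ₂ b hb a ha).symm
  have hJ₃' : ∀ a ∈ S', ∀ b ∈ S, Joined G S''ᶜ a b := fun a ha b hb => (hJ₃ b hb a ha).symm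
  rcases le_total i j with hij | hij <;> rcases le_total j k with hjk | hjk <;>
    rcases le_total i k with hik | hik
  · exact not_bag_subset_of_joined_compl hX h₁ h₂ h₃ hJ₂ hij hjk
  · exact not_bag_subset_of_joined_compl hX h₁ h₂ h₃ hJ₂ hij hjk
  · exact not_bag_subset_of_joined_compl hX h₁ h₃ h₂ hJ₃ hik hjk
  · exact not_bag_subset_of_joined_compl hX h₃ h₁ h₂ hJ₁' hik hij
  · exact not_bag_subset_of_joined_compl hX h₂ h₁ h₃ hJ₁ hij hik
  · exact not_bag_subset_of_joined_compl hX h₂ h₃ h₁ hJ₃' hjk hik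
  · exact not_bag_subset_of_joined_compl hX h₃ h₂ h₁ hJ₂' hjk hij
  · exact not_bag_subset_of_joined_compl hX h₃ h₂ h₁ hJ₂' hjk hij

end Pathwidth

/-! ### Complete binary trees -/

/-- The position in a heap-ordered binary tree to which position `i` is sent when the subtree at
`p` is replaced by the subtree at `s`. -/
def reroot (p s i : ℕ) : ℕ :=
  if i = p then s else if i = 0 then 0 else
    2 * reroot p s ((i - 1) / 2) + (i - 2 * ((i - 1) / 2))
termination_by i
decreasing_by omega

theorem reroot_self (p s : ℕ) : reroot p s p = s := by
  rw [reroot]; simp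

theorem reroot_of_ne {p s c i b : ℕ} (hc : c = 2 * i + b) (hb : b = 1 ∨ b = 2) (hcp : c ≠ p) :
    reroot p s c = 2 * reroot p s i + b := by
  rw [reroot, if_neg hcp, if_neg (by omega)]
  have : (c - 1) / 2 = i := by omega
  rw [this]
  omega

theorem exists_eq_two_mul_add {c : ℕ} (hc : c ≠ 0) : ∃ i b, c = 2 * i + b ∧ (b = 1 ∨ b = 2) :=
  ⟨(c - 1) / 2, c - 2 * ((c - 1) / 2), by omega, by omega⟩

theorem le_reroot_zero (s i : ℕ) : s ≤ reroot 0 s i := by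
  induction i using Nat.strong_induction_on with
  | _ c ih =>
    rcases eq_or_ne c 0 with rfl | hc
    · rw [reroot_self]
    obtain ⟨i, b, hi, hb⟩ := exists_eq_two_mul_add hc
    rw [reroot_of_ne hi hb hc]
    have := ih i (by omega)
    omega

/-- Proper descendants of `s` have numbers at least `2 * s + 1`, so the hypotheses ensure that
neither root lies properly below the other, and the two subtrees are equal or disjoint. The
induction goes up from both positions in parallel. -/
theorem reroot_zero_inj {s s' i j : ℕ} (hs : s' ≤ 2 * s) (hs' : s ≤ 2 * s')
    (h : reroot 0 s i = reroot 0 s' j) : s = s' ∧ i = j := by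
  induction i using Nat.strong_induction_on generalizing j with
  | _ c ih =>
    rcases eq_or_ne c 0 with rfl | hc <;> rcases eq_or_ne j 0 with rfl | hj
    · simpa [reroot_self] using h
    · obtain ⟨i, b, hi, hb⟩ := exists_eq_two_mul_add hj
      rw [reroot_self, reroot_of_ne hi hb hj] at h
      have := le_reroot_zero s' i
      omega
    · obtain ⟨i, b, hi, hb⟩ := exists_eq_two_mul_add hc
      rw [reroot_self, reroot_of_ne hi hb hc] at h
      have := le_reroot_zero s i
      omega
    · obtain ⟨i, b, hi, hb⟩ := exists_eq_two_mul_add hc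
      obtain ⟨i', b', hi', hb'⟩ := exists_eq_two_mul_add hj
      rw [reroot_of_ne hi hb hc, reroot_of_ne hi' hb' hj] at h
      have := ih i (by omega) (j := i') (by omega)
      omega

/-- Counted from one, the descendants of `s` that are `j` levels below it fill the range from `(s +
1) * 2 ^ j` up to, but excluding, `(s + 2) * 2 ^ j`. -/
theorem reroot_zero_lt {s h i : ℕ} (hi : i + 1 < 2 ^ (h + 1)) :
    reroot 0 s i + 1 < (s + 2) * 2 ^ h := by
  induction h generalizing i with
  | zero =>
    obtain rfl : i = 0 := by simpa using hi
    simp [reroot_self]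
  | succ h ih =>
    rcases eq_or_ne i 0 with rfl | hc
    · rw [reroot_self]
      have := Nat.one_le_two_pow (n := h + 1)
      nlinarith
    obtain ⟨j, b, hj, hb⟩ := exists_eq_two_mul_add hc
    rw [reroot_of_ne hj hb hc]
    have := ih (i := j) (by rw [pow_succ] at hi; omega)
    rw [pow_succ, ← mul_assoc]
    omega

theorem binaryTree_adj {h : ℕ} {i j : Fin (2 ^ h - 1)} :
    (binaryTree h).Adj i j ↔
      ((j : ℕ) = 2 * i + 1 ∨ (j : ℕ) = 2 * i + 2) ∨ ((i : ℕ) = 2 * j + 1 ∨ (i : ℕ) = 2 * j + 2) := by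
  simp only [binaryTree, SimpleGraph.fromRel_adj, ne_eq, Fin.ext_iff]
  omega

/-- The larger tree contains copies of the smaller one at the positions `3`, `4` and `5`, any two of
them joined outside the third. Were the pathwidths equal, each copy would contain a whole bag of an
optimal decomposition, against `not_three_bags`. -/
theorem pathwidth_binaryTree_lt {h : ℕ} (hh : h ≠ 0) :
    pathwidth (binaryTree h) < pathwidth (binaryTree (h + 2)) := by
  classical
  obtain ⟨h, rfl⟩ : ∃ k, h = k + 1 := ⟨h - 1, by omega⟩
  by_contra! hle
  set G := binaryTree (h + 1 + 2)
  obtain ⟨X, hX, hc⟩ := exists_isPathDecomposition_card_le G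
  have hpos : 8 ≤ 2 ^ (h + 1 + 2) := by
    rw [show h + 1 + 2 = h + 3 by ring, pow_add]
    have := Nat.one_le_two_pow (n := h)
    omega
  have hlt : ∀ s ≤ 5, ∀ i : Fin (2 ^ (h + 1) - 1), reroot 0 s i < 2 ^ (h + 1 + 2) - 1 := by
    intro s hs i
    have h1 := reroot_zero_lt (s := s) (h := h) (i := i) (by have := i.2; omega)
    have h2 : (s + 2) * 2 ^ h ≤ 7 * 2 ^ h := Nat.mul_le_mul_right _ (by omega)
    have h3 : 2 ^ (h + 1 + 2) = 8 * 2 ^ h := by ring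
    omega
  let S : ℕ → Set (Fin (2 ^ (h + 1 + 2) - 1)) := fun s =>
    {x | ∃ i : Fin (2 ^ (h + 1) - 1), reroot 0 s i = x}
  -- The decomposition restricted to the copy has a bag with at least `pathwidth G + 1` vertices.
  -- The bag it comes from has at most that many, so it consists of vertices of the copy only.
  have hbag : ∀ s, 3 ≤ s → s ≤ 5 → ∃ B ∈ X, B.Nonempty ∧ ↑B ⊆ S s := by
    intro s hs3 hs5
    let e : Fin (2 ^ (h + 1) - 1) → Fin (2 ^ (h + 1 + 2) - 1) := fun i => ⟨_, hlt s hs5 i⟩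
    have he : Function.Injective e := fun i j hij =>
      Fin.ext (reroot_zero_inj (s := s) (by omega) (by omega) (Fin.ext_iff.1 hij)).2
    have hpi : ∀ i, Function.partialInv e (e i) = some i := Function.partialInv_left he
    have hinv : ∀ x i, Function.partialInv e x = some i → e i = x := fun x i hx =>
      (he.isPartialInv i x).1 hx
    obtain ⟨Y, hY, hYX⟩ := hX.map_minor (G := binaryTree (h + 1)) (Function.partialInv e)
      (fun v a b ha hb => by
        obtain rfl := hinv _ _ ha
        obtain rfl := hinv _ _ hb
        exact Joined.refl ha)
      (fun v => ⟨_, hpi v⟩)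
      (fun u v huv => ⟨_, _, hpi u, hpi v, by
        rw [binaryTree_adj] at huv ⊢
        have key : ∀ u v : Fin (2 ^ (h + 1) - 1), ((v : ℕ) = 2 * u + 1 ∨ (v : ℕ) = 2 * u + 2) →
            ((e v : ℕ) = 2 * e u + 1 ∨ (e v : ℕ) = 2 * e u + 2) := by
          rintro u v (huv | huv)
          · exact Or.inl (reroot_of_ne huv (by simp) (by omega))
          · exact Or.inr (reroot_of_ne huv (by simp) (by omega))
        exact huv.imp (key u v) (key v u)⟩)
    obtain ⟨B, hB, hBc⟩ : ∃ B ∈ Y, pathwidth G + 1 ≤ B.card := by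
      -- With pathwidth `0` there is no smaller `k` to apply `exists_card_lt_of_lt_pathwidth` to;
      -- any nonempty bag will do.
      rcases Nat.eq_zero_or_pos (pathwidth G) with h0 | h0
      · obtain ⟨B, hB, hv⟩ := hY.cover ⟨0, by
          have := Nat.one_le_two_pow (n := h); rw [pow_succ]; omega⟩
        exact ⟨B, hB, by rw [h0]; exact Finset.card_pos.2 ⟨_, hv⟩⟩
      · obtain ⟨B, hB, hc⟩ := exists_card_lt_of_lt_pathwidth hY
          (k := pathwidth G - 1) (by omega)
        exact ⟨B, hB, by omega⟩
    obtain ⟨A, hA, hBA, hsub⟩ := hYX B hB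
    have hBim : B.image e ⊆ A := by
      intro x hx
      obtain ⟨i, hi, rfl⟩ := Finset.mem_image.1 hx
      obtain ⟨a, ha, hai⟩ := hsub i hi
      rwa [hinv a i hai]
    have hA' : B.image e = A := Finset.eq_of_subset_of_card_le hBim (by
      rw [Finset.card_image_of_injective _ he]
      exact (hc A hA).trans hBc)
    refine ⟨A, hA, Finset.card_pos.1 (by omega), fun x hx => ?_⟩
    rw [← hA'] at hx
    obtain ⟨i, hi, rfl⟩ := Finset.mem_image.1 (Finset.mem_coe.1 hx)
    exact ⟨i, rfl⟩
  have hdisj : ∀ s s', 3 ≤ s → s ≤ 5 → 3 ≤ s' → s' ≤ 5 → s ≠ s' → ∀ x ∈ S s, x ∉ S s' := by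
    rintro s s' h1 h2 h3 h4 hne x ⟨i, hi⟩ ⟨j, hj⟩
    exact hne (reroot_zero_inj (by omega) (by omega) (hi.trans hj.symm)).1
  have hge : ∀ s, ∀ x ∈ S s, s ≤ x := by
    rintro s x ⟨i, hi⟩
    rw [← hi]
    exact le_reroot_zero _ _
  -- The default value is never used: only `k ≤ 5` occurs, and there are at least seven vertices.
  let y : ℕ → Fin (2 ^ (h + 1 + 2) - 1) := fun k => if hk : k < 2 ^ (h + 1 + 2) - 1 then ⟨k, hk⟩ else
    ⟨0, by omega⟩
  have hy : ∀ k ≤ 5, (y k : ℕ) = k := fun k hk => by simp only [y]; rw [dif_pos (by omega)]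
  have hroot : ∀ s, s ≤ 5 → ∀ x ∈ S s, Joined G (S s) x (y s) := by
    rintro s hs5 x ⟨⟨i, hi⟩, hx⟩
    induction i using Nat.strong_induction_on generalizing x with
    | _ c ih =>
      rcases eq_or_ne c 0 with rfl | hc0
      · have : x = y s := Fin.ext (by rw [hy s hs5, ← hx]; exact reroot_self _ _)
        rw [← this]
        exact .refl ⟨⟨0, hi⟩, hx⟩
      obtain ⟨i, b, hib, hb⟩ := exists_eq_two_mul_add hc0
      have hi' : i < 2 ^ (h + 1) - 1 := by omega
      refine Joined.trans (.adj (b := ⟨_, hlt s hs5 ⟨i, hi'⟩⟩) ?_ ⟨⟨c, hi⟩, hx⟩ ⟨⟨i, hi'⟩, rfl⟩)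
        (ih i (by omega) _ hi' rfl)
      rw [binaryTree_adj]
      simp only at hx ⊢
      rw [reroot_of_ne hib hb hc0] at hx
      omega
  have hadj : ∀ i j, i ≤ 5 → j ≤ 5 → (j = 2 * i + 1 ∨ j = 2 * i + 2) → G.Adj (y i) (y j) := by
    intro i j hi hj hij
    rw [binaryTree_adj, hy i hi, hy j hj]
    exact Or.inl hij
  have hyS : ∀ k ≤ 2, ∀ s, 3 ≤ s → y k ∈ (S s)ᶜ := by
    intro k hk s hs hmem
    have := hge s _ hmem
    rw [hy k (by omega)] at this
    omega
  have hyS' : ∀ k s, 3 ≤ k → k ≤ 5 → 3 ≤ s → s ≤ 5 → k ≠ s → y k ∈ (S s)ᶜ := by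
    intro k s h1 h2 h3 h4 hne
    refine hdisj k s h1 h2 h3 h4 hne _ ⟨⟨0, ?_⟩, ?_⟩
    · have := Nat.one_le_two_pow (n := h); rw [pow_succ]; omega
    · rw [hy k h2]; exact reroot_self _ _
  -- Vertex `1` serves as a meeting point: `3` and `4` are its children, and `5` reaches it through
  -- `2` and `0`. None of `0`, `1`, `2` lies in a copy.
  have hcomm : ∀ s k, 3 ≤ k → k ≤ 5 → 3 ≤ s → s ≤ 5 → k ≠ s → ∀ a ∈ S k,
      Joined G (S s)ᶜ a (y 1) := by
    intro s k h1 h2 h3 h4 hne a ha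
    refine Joined.trans ((hroot k h2 a ha).mono fun x hx => hdisj k s h1 h2 h3 h4 hne x hx) ?_
    have hk := hyS' k s h1 h2 h3 h4 hne
    have hyS1 := fun k hk => hyS k hk s h3
    interval_cases k
    · exact (Joined.adj (hadj 1 3 (by simp) (by simp) (by simp)) (hyS1 1 (by simp)) hk).symm
    · exact (Joined.adj (hadj 1 4 (by simp) (by simp) (by simp)) (hyS1 1 (by simp)) hk).symm
    · exact ((Joined.adj (hadj 2 5 (by simp) (by simp) (by simp)) (hyS1 2 (by simp)) hk).symm.trans
        (Joined.adj (hadj 0 2 (by simp) (by simp) (by simp)) (hyS1 0 (by simp))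
          (hyS1 2 (by simp))).symm).trans
        (Joined.adj (hadj 0 1 (by simp) (by simp) (by simp)) (hyS1 0 (by simp)) (hyS1 1 (by simp)))
  have hJ : ∀ s k l, 3 ≤ k → k ≤ 5 → 3 ≤ l → l ≤ 5 → 3 ≤ s → s ≤ 5 → k ≠ s → l ≠ s →
      ∀ a ∈ S k, ∀ b ∈ S l, Joined G (S s)ᶜ a b := fun s k l h1 h2 h3 h4 h5 h6 h7 h8 a ha b hb =>
    (hcomm s k h1 h2 h5 h6 h7 a ha).trans (hcomm s l h3 h4 h5 h6 h8 b hb).symm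
  exact not_three_bags hX (hbag 3 (by simp) (by simp)) (hbag 4 (by simp) (by simp))
    (hbag 5 (by simp) (by simp)) (hJ 3 4 5 (by simp) (by simp) (by simp) (by simp) (by simp)
      (by simp) (by simp) (by simp)) (hJ 4 3 5 (by simp) (by simp) (by simp) (by simp) (by simp)
      (by simp) (by simp) (by simp)) (hJ 5 3 4 (by simp) (by simp) (by simp) (by simp) (by simp)
      (by simp) (by simp) (by simp))

theorem lt_pathwidth_binaryTree (t : ℕ) : t < pathwidth (binaryTree (2 * t + 2)) := by
  induction t with
  | zero =>
    obtain ⟨X, hX, hc⟩ := exists_isPathDecomposition_card_le (binaryTree 2)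
    obtain ⟨B, hB, h0, h1⟩ := hX.edge ⟨0, by simp⟩ ⟨1, by simp⟩ (by rw [binaryTree_adj]; simp)
    have h2 : 1 < B.card := Finset.one_lt_card.2 ⟨_, h0, _, h1, by simp⟩
    have := hc B hB
    change 0 < pathwidth (binaryTree 2)
    omega
  | succ t ih =>
    have := pathwidth_binaryTree_lt (h := 2 * t + 2) (by omega)
    rw [show 2 * (t + 1) + 2 = 2 * t + 2 + 2 by ring]
    omega

theorem lt_pathwidth_binaryTree_guestHeight (t : ℕ) :
    t < pathwidth (binaryTree (guestHeight t)) :=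
  Nat.sInf_mem (s := {h | t < pathwidth (binaryTree h)}) ⟨_, lt_pathwidth_binaryTree t⟩

theorem guestOrder_le (t : ℕ) : guestOrder t ≤ 2 ^ (2 * t + 2) - 1 := by
  have : guestHeight t ≤ 2 * t + 2 :=
    Nat.sInf_le (s := {h | t < pathwidth (binaryTree h)}) (lt_pathwidth_binaryTree t)
  exact Nat.sub_le_sub_right (Nat.pow_le_pow_right (by simp) this) 1

theorem guestOrder_pos (t : ℕ) : 0 < guestOrder t := by
  have h := lt_pathwidth_binaryTree_guestHeight t
  unfold guestOrder
  rcases Nat.eq_zero_or_pos (guestHeight t) with h0 | h0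
  · rw [h0] at h
    -- The tree without levels has the empty decomposition, whose truncated width is `0`, so
    -- `guestHeight t` is positive.
    have : pathwidth (binaryTree 0) ≤ 0 :=
      pathwidth_le (X := []) ⟨fun v => absurd v.2 (by simp), fun v => absurd v.2 (by simp),
        fun i j k _ _ hk => by simp at hk⟩ (by simp)
    omega
  · have := Nat.one_lt_two_pow h0.ne'
    omega

/-! ### Moving a subtree up in heap order. -/

section Reroot

variable {p s : ℕ}

/-- `c` is a child of `i` in the heap order. -/
def IsChild (c i : ℕ) : Prop := c = 2 * i + 1 ∨ c = 2 * i + 2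

theorem IsChild.lt {c i : ℕ} (h : IsChild c i) : i < c := by
  rcases h with h | h <;> omega

theorem IsChild.ne_zero {c i : ℕ} (h : IsChild c i) : c ≠ 0 := by
  rcases h with h | h <;> omega

theorem IsChild.parent_eq {c i j : ℕ} (h : IsChild c i) (h' : IsChild c j) : i = j := by
  rcases h with h | h <;> rcases h' with h' | h' <;> omega

theorem exists_isChild {c : ℕ} (hc : c ≠ 0) : ∃ i, IsChild c i := by
  obtain ⟨i, b, h, rfl | rfl⟩ := exists_eq_two_mul_add hc
  exacts [⟨i, .inl h⟩, ⟨i, .inr h⟩]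

theorem reroot_isChild {c i : ℕ} (h : IsChild c i) (hcp : c ≠ p) :
    IsChild (reroot p s c) (reroot p s i) := by
  rcases h with h | h
  · exact .inl (reroot_of_ne h (by simp) hcp)
  · exact .inr (reroot_of_ne h (by simp) hcp)

theorem reroot_of_lt {i : ℕ} (h : i < p) : reroot p s i = i := by
  induction i using Nat.strong_induction_on with
  | _ c ih =>
    rcases eq_or_ne c 0 with rfl | hc
    · rw [reroot, if_neg (by omega), if_pos rfl]
    obtain ⟨i, b, hi, hb⟩ := exists_eq_two_mul_add hc
    rw [reroot_of_ne hi hb (by omega), ih i (by omega) (by omega)]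
    omega

/-- Contents move only to smaller or equal positions. This keeps the occupied positions below `N`
and lets the machine copy in place. -/
theorem le_reroot (hs : p ≤ s) (i : ℕ) : i ≤ reroot p s i := by
  induction i using Nat.strong_induction_on with
  | _ c ih =>
    rcases eq_or_ne c p with rfl | hcp
    · rwa [reroot_self]
    rcases eq_or_ne c 0 with rfl | hc
    · simp
    obtain ⟨i, b, hi, hb⟩ := exists_eq_two_mul_add hc
    rw [reroot_of_ne hi hb hcp]
    have := ih i (by omega)
    omega

/-- The position `p` is not the source of anything: its token is the one that a contraction drops.
-/
theorem reroot_ne (hs : p < s) (i : ℕ) : reroot p s i ≠ p := by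
  rcases lt_trichotomy i p with h | rfl | h
  · rw [reroot_of_lt h]; omega
  · rw [reroot_self]; omega
  · have := le_reroot hs.le i; omega

/-- Only `p` is sent to `s`: the parent of any other such position would be sent to `p`, against
`reroot_ne`. All other positions are compared through their parents. -/
theorem reroot_injective (hs : IsChild s p) : Function.Injective (reroot p s) := by
  have h0 : ∀ j, j ≠ p → reroot p s j ≠ s := by
    intro j hj h
    rcases eq_or_ne j 0 with rfl | hj0
    · rw [reroot_of_lt (by omega)] at h
      exact hs.ne_zero h.symm
    obtain ⟨i, hi⟩ := exists_isChild hj0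
    have := reroot_isChild (s := s) hi hj
    rw [h] at this
    exact reroot_ne hs.lt i (this.parent_eq hs)
  intro i j h
  induction i using Nat.strong_induction_on generalizing j with
  | _ i ih =>
    rcases eq_or_ne i p with hi | hi <;> rcases eq_or_ne j p with hj | hj
    · rw [hi, hj]
    · rw [hi, reroot_self] at h
      exact absurd h.symm (h0 j hj)
    · rw [hj, reroot_self] at h
      exact absurd h (h0 i hi)
    · rcases eq_or_ne i 0 with rfl | hi0
      · rw [reroot_of_lt (by omega)] at h
        have := le_reroot hs.lt.le j
        omega
      rcases eq_or_ne j 0 with rfl | hj0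
      · rw [reroot_of_lt (i := 0) (by omega)] at h
        have := le_reroot hs.lt.le i
        omega
      obtain ⟨i', b, hi', hb⟩ := exists_eq_two_mul_add hi0
      obtain ⟨j', b', hj', hb'⟩ := exists_eq_two_mul_add hj0
      rw [reroot_of_ne hi' hb hi, reroot_of_ne hj' hb' hj] at h
      have := ih i' (by omega) (j := j') (by omega)
      omega

end Reroot

/-! ### The state of the algorithm -/

/-- Position `i` of the guest tree is occupied if `branch i ≠ []`. Then `branch i` consists of the
vertex at position `i` and of the inner vertices of the path from it to the vertex at the parent
position. The search forest is given by `par` (roots are their own parents, `none` stands for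
unvisited vertices), `scan v` counts the neighbours of `v` that have been looked at, and all
vertices below `next` have been visited. -/
structure State (n : ℕ) where
  branch : ℕ → List (Fin n)
  par : Fin n → Option (Fin n)
  scan : Fin n → ℕ
  next : ℕ
  bags : List (List (Fin n))

/-- The list of the heads of the first `N` lists. -/
def heads {α : Type*} (N : ℕ) (f : ℕ → List α) : List α :=
  (List.range N).filterMap fun i => (f i).head?

theorem mem_heads {α : Type*} {N : ℕ} {f : ℕ → List α} {v : α} :
    v ∈ heads N f ↔ ∃ i < N, (f i).head? = some v := by
  simp [heads]

theorem length_heads_le {α : Type*} (N : ℕ) (f : ℕ → List α) : (heads N f).length ≤ N := by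
  have := List.length_filterMap_le (fun i => (f i).head?) (List.range N)
  rwa [List.length_range] at this

theorem mem_of_head?_eq {α : Type*} {l : List α} {v : α} (h : l.head? = some v) : v ∈ l := by
  cases l <;> simp_all

theorem ne_nil_of_head?_eq {α : Type*} {l : List α} {v : α} (h : l.head? = some v) : l ≠ [] := by
  rintro rfl; simp at h

theorem nodup_heads {α : Type*} {N : ℕ} {f : ℕ → List α}
    (hf : ∀ i j, i ≠ j → (f i).Disjoint (f j)) : (heads N f).Nodup := by
  refine List.Nodup.filterMap ?_ List.nodup_range
  intro i j v hi hj
  by_contra hij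
  exact hf i j hij (mem_of_head?_eq hi) (mem_of_head?_eq hj)

namespace State

variable {n : ℕ}

/-- Put the unvisited vertex `y`, found from `x`, at the position `c`, and write a bag. -/
def place (a : State n) (N c : ℕ) (x y : Fin n) : State n where
  branch := Function.update a.branch c [y]
  par := Function.update a.par y (some x)
  scan := a.scan
  next := a.next
  bags := a.bags ++ [heads N (Function.update a.branch c [y])]

/-- Count one more neighbour of `v`. -/
def advance (a : State n) (v : Fin n) : State n :=
  { a with scan := Function.update a.scan v (a.scan v + 1) }

/-- Replace the vertex at the position `p` by the subtree at the position `s`. -/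
def contract (a : State n) (p s : ℕ) : State n :=
  { a with branch := fun i => if a.branch (reroot p s i) = [] then [] else
      a.branch (reroot p s i) ++ if i = p then a.branch p else [] }

/-- The vertices present in the guest tree. -/
def active (a : State n) (N : ℕ) : Finset (Fin n) := (heads N a.branch).toFinset

/-- The unvisited vertices. -/
def unvisited (a : State n) : Finset (Fin n) := Finset.univ.filter fun v => a.par v = none

theorem mem_unvisited {a : State n} {v : Fin n} : v ∈ a.unvisited ↔ a.par v = none := by
  simp [unvisited]

/-- A bound on the number of steps that remain. -/
def potential (A : Fin n → List (Fin n)) (N : ℕ) (a : State n) : ℕ :=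
  (n - a.next) + 2 * a.unvisited.card + (a.active N).card + ∑ v, ((A v).length - a.scan v)

/-- `b` is the parent of `a` in the search forest. -/
def Up (H : SimpleGraph (Fin n)) (a : State n) (u v : Fin n) : Prop :=
  a.par u = some v ∧ H.Adj u v

/-- The invariant of the algorithm, for the adjacency lists `A` and `N` positions. -/
structure Inv (H : SimpleGraph (Fin n)) (A : Fin n → List (Fin n)) (N : ℕ) (a : State n) :
    Prop where
  range : ∀ i, a.branch i ≠ [] → i < N
  closed : ∀ i c, IsChild c i → a.branch c ≠ [] → a.branch i ≠ []
  nodup : ∀ i, (a.branch i).Nodup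
  disjoint : ∀ i j, i ≠ j → (a.branch i).Disjoint (a.branch j)
  visited : ∀ i, ∀ v ∈ a.branch i, a.par v ≠ none
  chain : ∀ i, (a.branch i).IsChain (a.Up H)
  link : ∀ i c, IsChild c i → ∀ u ∈ (a.branch c).getLast?, ∀ v ∈ (a.branch i).head?, a.Up H u v
  scan_visited : ∀ v, ∀ k < a.scan v, ∀ w, (A v)[k]? = some w → a.par w ≠ none
  scan_le : ∀ v, a.scan v ≤ (A v).length
  scan_unvisited : ∀ v, a.par v = none → a.scan v = 0
  dead : ∀ v, a.par v ≠ none → (∀ i, (a.branch i).head? ≠ some v) → a.scan v = (A v).length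
  next_visited : ∀ v : Fin n, (v : ℕ) < a.next → a.par v ≠ none
  next_le : a.next ≤ n
  mem_bags : ∀ v, a.par v ≠ none ↔ ∃ B ∈ a.bags, v ∈ B
  length_bags : a.bags.length + a.unvisited.card = n
  bag_nodup : ∀ B ∈ a.bags, B.Nodup
  bag_length : ∀ B ∈ a.bags, B.length ≤ N
  interp : ∀ (i j k : ℕ) (hij : i < j) (hjk : j < k) (hk : k < a.bags.length) (v : Fin n),
    v ∈ a.bags[i] → v ∈ a.bags[k] → v ∈ a.bags[j]
  active_bags : ∀ (i : ℕ) (v : Fin n), (a.branch i).head? = some v →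
    ∀ (j k : ℕ) (hjk : j < k) (hk : k < a.bags.length), v ∈ a.bags[j] → v ∈ a.bags[k]
  edge : ∀ u v, H.Adj u v → a.par u ≠ none → a.par v ≠ none → ∃ B ∈ a.bags, u ∈ B ∧ v ∈ B

variable {H : SimpleGraph (Fin n)} {A : Fin n → List (Fin n)} {N : ℕ} {a : State n}

/-! ### Preservation of the invariant and decrease of the potential. -/

theorem Inv.children_empty (ha : a.Inv H A N) {c d : ℕ} (hc : a.branch c = [])
    (hd : IsChild d c) : a.branch d = [] := by
  by_contra h
  exact ha.closed c d hd h hc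

theorem Inv.neighbour_visited (hA : ∀ v w, w ∈ A v ↔ H.Adj v w) (ha : a.Inv H A N) {v w : Fin n}
    (hv : a.scan v = (A v).length) (hvw : H.Adj v w) : a.par w ≠ none := by
  obtain ⟨k, hk, hkw⟩ := List.getElem_of_mem ((hA v w).2 hvw)
  exact ha.scan_visited v k (by omega) w (by rw [List.getElem?_eq_getElem hk, hkw])

/-- A visited neighbour `v` of `y` that is no longer a token would have been scanned completely, so
`y` would have been visited. Hence every visited neighbour of `y` is a token and shares the new bag
with it. For the root position the hypothesis `hx` is vacuous. -/
theorem Inv.place (hA : ∀ v w, w ∈ A v ↔ H.Adj v w) (ha : a.Inv H A N) {c : ℕ} {x y : Fin n}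
    (hc : a.branch c = []) (hcN : c < N) (hy : a.par y = none)
    (hx : ∀ p, IsChild c p → (a.branch p).head? = some x ∧ H.Adj y x) :
    (a.place N c x y).Inv H A N := by
  have hynot : ∀ i, y ∉ a.branch i := fun i h => ha.visited i y h hy
  have hpar : ∀ v, (a.place N c x y).par v ≠ none ↔ v = y ∨ a.par v ≠ none := by
    intro v
    rcases eq_or_ne v y with rfl | hv <;> simp [State.place, *]
  have hup : ∀ u v, u ≠ y → a.Up H u v → (a.place N c x y).Up H u v := by
    intro u v hu h
    exact ⟨by simpa [State.place, hu] using h.1, h.2⟩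
  have hbr : ∀ i, i ≠ c → (a.place N c x y).branch i = a.branch i := by
    intro i hi; simp [State.place, hi]
  have hbc : (a.place N c x y).branch c = [y] := by simp [State.place]
  have hybag : ∀ B ∈ a.bags, y ∉ B := fun B hB h => (ha.mem_bags y).2 ⟨B, hB, h⟩ hy
  have hnew : (a.place N c x y).bags = a.bags ++ [heads N (a.place N c x y).branch] := rfl
  have hhead : ∀ i v, ((a.place N c x y).branch i).head? = some v →
      v ∈ heads N (a.place N c x y).branch := by
    intro i v hv
    refine mem_heads.2 ⟨i, ?_, hv⟩
    rcases eq_or_ne i c with rfl | hi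
    · exact hcN
    · exact ha.range i (by rw [← hbr i hi]; exact ne_nil_of_head?_eq hv)
  have hyhead : y ∈ heads N (a.place N c x y).branch := hhead c y (by rw [hbc]; rfl)
  have hheadv : ∀ v ∈ heads N (a.place N c x y).branch, v ≠ y →
      ∃ i, (a.branch i).head? = some v := by
    intro v hv hvy
    obtain ⟨i, -, hi⟩ := mem_heads.1 hv
    rcases eq_or_ne i c with rfl | hic
    · rw [hbc] at hi; simp at hi; exact absurd hi.symm hvy
    · exact ⟨i, by rw [← hbr i hic]; exact hi⟩
  have hactive : ∀ v, (∃ i, (a.branch i).head? = some v) →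
      ∃ i, ((a.place N c x y).branch i).head? = some v := by
    rintro v ⟨i, hi⟩
    refine ⟨i, ?_⟩
    rw [hbr i (by rintro rfl; simp [hc] at hi), hi]
  have hdisj : ∀ i j, i ≠ j →
      ((a.place N c x y).branch i).Disjoint ((a.place N c x y).branch j) := by
    intro i j hij
    rcases eq_or_ne i c with rfl | hi
    · rw [hbc, hbr j hij.symm]
      simpa using hynot j
    · rw [hbr i hi]
      rcases eq_or_ne j c with rfl | hj
      · rw [hbc]
        simpa using hynot i
      · rw [hbr j hj]; exact ha.disjoint i j hij
  have hedge : ∀ v, H.Adj y v → a.par v ≠ none → ∃ B ∈ (a.place N c x y).bags, y ∈ B ∧ v ∈ B := by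
    intro v hyv hv
    by_cases hact : ∃ i, (a.branch i).head? = some v
    · obtain ⟨i, hi⟩ := hactive v hact
      exact ⟨_, by rw [hnew]; simp, hyhead, hhead i v hi⟩
    · push Not at hact
      exact absurd hy (ha.neighbour_visited hA (ha.dead v hv hact) hyv.symm)
  refine ⟨?_, ?_, ?_, hdisj, ?_, ?_, ?_, ?_, ?_, ?_, ?_, ?_, ha.next_le, ?_, ?_, ?_, ?_, ?_, ?_, ?_⟩
  · intro i hi
    rcases eq_or_ne i c with rfl | hic
    · exact hcN
    · exact ha.range i (by rwa [hbr i hic] at hi)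
  · intro i d hd hne
    rcases eq_or_ne d c with rfl | hdc
    · rw [hbr i hd.lt.ne]
      exact ne_nil_of_head?_eq (hx i hd).1
    · rw [hbr d hdc] at hne
      rcases eq_or_ne i c with rfl | hic
      · rw [hbc]; simp
      · rw [hbr i hic]; exact ha.closed i d hd hne
  · intro i
    rcases eq_or_ne i c with rfl | hic
    · rw [hbc]; simp
    · rw [hbr i hic]; exact ha.nodup i
  · intro i v hv
    rw [hpar]
    rcases eq_or_ne i c with rfl | hic
    · rw [hbc] at hv; simp at hv; exact .inl hv
    · rw [hbr i hic] at hv; exact .inr (ha.visited i v hv)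
  · intro i
    rcases eq_or_ne i c with rfl | hic
    · rw [hbc]; simp
    · rw [hbr i hic]
      refine List.IsChain.imp_of_mem_imp (R := a.Up H) ?_ (ha.chain i)
      intro u v hu hv h
      exact hup u v (by rintro rfl; exact hynot i hu) h
  · intro i d hd u hu v hv
    rcases eq_or_ne d c with rfl | hdc
    · rw [hbr i hd.lt.ne, (hx i hd).1] at hv
      rw [hbc] at hu
      simp at hu hv
      subst hu hv
      exact ⟨by simp [State.place], (hx i hd).2⟩
    · rw [hbr d hdc] at hu
      rcases eq_or_ne i c with rfl | hic
      · rw [ha.children_empty hc hd] at hu; simp at hu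
      · rw [hbr i hic] at hv
        refine hup u v ?_ (ha.link i d hd u hu v hv)
        rintro rfl
        exact hynot d (List.mem_of_getLast? hu)
  · intro v k hk w hw
    rw [hpar]
    exact .inr (ha.scan_visited v k hk w hw)
  · exact ha.scan_le
  · intro v hv
    refine ha.scan_unvisited v ?_
    by_contra h
    exact (hpar v).2 (.inr h) hv
  · intro v hv hact
    rw [hpar] at hv
    rcases hv with rfl | hv
    · exact absurd (by rw [hbc]; rfl) (hact c)
    · refine ha.dead v hv fun i hi => ?_
      obtain ⟨j, hj⟩ := hactive v ⟨i, hi⟩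
      exact hact j hj
  · intro v hv
    rw [hpar]
    exact .inr (ha.next_visited v hv)
  · intro v
    rw [hpar, hnew, ha.mem_bags v]
    constructor
    · rintro (rfl | ⟨B, hB, hv⟩)
      · exact ⟨_, by simp, hyhead⟩
      · exact ⟨B, by simp [hB], hv⟩
    · rintro ⟨B, hB, hv⟩
      simp only [List.mem_append, List.mem_singleton] at hB
      rcases hB with hB | rfl
      · exact .inr ⟨B, hB, hv⟩
      · rcases eq_or_ne v y with rfl | hvy
        · exact .inl rfl
        · obtain ⟨i, hi⟩ := hheadv v hv hvy
          exact .inr ((ha.mem_bags v).1 (ha.visited i v (mem_of_head?_eq hi)))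
  · have h1 : (a.place N c x y).unvisited = a.unvisited.erase y := by
      ext v
      have := hpar v
      rw [Finset.mem_erase, mem_unvisited, mem_unvisited]
      tauto
    have h2 : y ∈ a.unvisited := by simp [unvisited, hy]
    have h3 := Finset.card_erase_add_one h2
    have h4 := ha.length_bags
    rw [h1, hnew]
    simp only [List.length_append, List.length_singleton]
    omega
  · intro B hB
    rw [hnew] at hB
    simp only [List.mem_append, List.mem_singleton] at hB
    rcases hB with hB | rfl
    · exact ha.bag_nodup B hB
    · exact nodup_heads hdisj
  · intro B hB
    rw [hnew] at hB
    simp only [List.mem_append, List.mem_singleton] at hB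
    rcases hB with hB | rfl
    · exact ha.bag_length B hB
    · exact length_heads_le _ _
  · intro i j k hij hjk hk v hi hk'
    simp only [hnew, List.length_append, List.length_singleton] at hi hk hk' ⊢
    rw [List.getElem_append_left (by omega)] at hi ⊢
    rcases Nat.lt_succ_iff_lt_or_eq.1 hk with hk | rfl
    · rw [List.getElem_append_left (by omega)] at hk'
      exact ha.interp i j k hij hjk hk v hi hk'
    · rw [List.getElem_append_right (by omega)] at hk'
      simp only [Nat.sub_self, List.getElem_cons_zero] at hk'
      -- No old bag contains `y`. A vertex of an old bag and of the new one was therefore a token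
      -- already, and `active_bags` fills the gap.
      have hvy : v ≠ y := by
        rintro rfl
        exact hybag _ (List.getElem_mem _) hi
      obtain ⟨l, hl⟩ := hheadv v hk' hvy
      exact ha.active_bags l v hl i j hij hjk hi
  · intro i v hi j k hjk hk hj
    simp only [hnew, List.length_append, List.length_singleton] at hj hk ⊢
    rw [List.getElem_append_left (by omega)] at hj
    rcases Nat.lt_succ_iff_lt_or_eq.1 hk with hk | rfl
    · rw [List.getElem_append_left (by omega)]
      have hvy : v ≠ y := by
        rintro rfl
        exact hybag _ (List.getElem_mem _) hj
      obtain ⟨l, hl⟩ := hheadv v (hhead i v hi) hvy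
      exact ha.active_bags l v hl j k hjk hk hj
    · rw [List.getElem_append_right (by omega)]
      simpa using hhead i v hi
  · intro u v huv hu hv
    rw [hpar] at hu hv
    rcases hu with rfl | hu
    · rcases hv with rfl | hv
      · exact absurd huv (H.loopless.irrefl _)
      · exact hedge v huv hv
    · rcases hv with rfl | hv
      · obtain ⟨B, hB, h1, h2⟩ := hedge u huv.symm hu
        exact ⟨B, hB, h2, h1⟩
      · obtain ⟨B, hB, h⟩ := ha.edge u v huv hu hv
        exact ⟨B, by rw [hnew]; simp [hB], h⟩

/-- The weight `2` of an unvisited vertex pays for the token that it becomes. -/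
theorem potential_place {c : ℕ} {x y : Fin n} (hy : a.par y = none) :
    (a.place N c x y).potential A N + 1 ≤ a.potential A N := by
  have h1 : (a.place N c x y).unvisited = a.unvisited.erase y := by
    ext v
    rw [Finset.mem_erase, mem_unvisited, mem_unvisited]
    rcases eq_or_ne v y with rfl | hv <;> simp [State.place, *]
  have h2 : y ∈ a.unvisited := by simp [unvisited, hy]
  have h3 := Finset.card_erase_add_one h2
  have h4 : ((a.place N c x y).active N).card ≤ (a.active N).card + 1 := by
    refine (Finset.card_le_card ?_).trans (Finset.card_insert_le y (a.active N))
    intro v hv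
    simp only [active, List.mem_toFinset, mem_heads, Finset.mem_insert] at hv ⊢
    obtain ⟨i, hi, hv⟩ := hv
    rcases eq_or_ne i c with rfl | hic
    · left; simpa [State.place, eq_comm] using hv
    · right; exact ⟨i, hi, by simpa [State.place, hic] using hv⟩
  unfold potential
  rw [h1]
  simp only [State.place] at h4 ⊢
  omega

theorem Inv.advance (ha : a.Inv H A N) {v w : Fin n} (hv : a.par v ≠ none)
    (hw : (A v)[a.scan v]? = some w) (hpw : a.par w ≠ none) : (a.advance v).Inv H A N := by
  have hlt : a.scan v < (A v).length := (List.getElem?_eq_some_iff.1 hw).1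
  refine { ha with scan_visited := ?_, scan_le := ?_, scan_unvisited := ?_, dead := ?_ }
  · intro u k hk z hz
    rcases eq_or_ne u v with rfl | huv
    · simp only [State.advance, Function.update_self] at hk
      rcases Nat.lt_succ_iff_lt_or_eq.1 hk with hk | rfl
      · exact ha.scan_visited u k hk z hz
      · rw [hz] at hw
        cases hw
        exact hpw
    · simp only [State.advance, Function.update_of_ne huv] at hk
      exact ha.scan_visited u k hk z hz
  · intro u
    rcases eq_or_ne u v with rfl | huv
    · simpa [State.advance] using hlt
    · simpa [State.advance, huv] using ha.scan_le u
  · intro u hu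
    have : u ≠ v := by rintro rfl; exact hv hu
    simpa [State.advance, this] using ha.scan_unvisited u hu
  · intro u hu hact
    have hd := ha.dead u hu hact
    rcases eq_or_ne u v with rfl | huv
    · omega
    · simpa [State.advance, huv] using hd

theorem potential_advance {v : Fin n} (hv : a.scan v < (A v).length) :
    (a.advance v).potential A N + 1 ≤ a.potential A N := by
  have h : ∑ u, ((A u).length - (a.advance v).scan u) < ∑ u, ((A u).length - a.scan u) := by
    refine Finset.sum_lt_sum (fun u _ => ?_) ⟨v, Finset.mem_univ _, ?_⟩
    · rcases eq_or_ne u v with rfl | huv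
      · simp only [State.advance, Function.update_self]; omega
      · simp [State.advance, huv]
    · simp only [State.advance, Function.update_self]; omega
  have h1 : (a.advance v).unvisited = a.unvisited := rfl
  have h2 : (a.advance v).active N = a.active N := rfl
  have h3 : (a.advance v).next = a.next := rfl
  unfold potential
  rw [h1, h2, h3]
  omega

theorem Inv.next_succ (ha : a.Inv H A N) {v : Fin n} (hv : (v : ℕ) = a.next)
    (hp : a.par v ≠ none) :
    ({ a with next := a.next + 1 } : State n).Inv H A N ∧
      ({ a with next := a.next + 1 } : State n).potential A N + 1 ≤ a.potential A N := by
  constructor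
  · refine { ha with next_visited := ?_, next_le := ?_ }
    · intro u hu
      simp only at hu ⊢
      rcases Nat.lt_succ_iff_lt_or_eq.1 hu with hu | hu
      · exact ha.next_visited u hu
      · obtain rfl : u = v := Fin.ext (by omega)
        exact hp
    · simp only
      omega
  · simp only [potential, active, unvisited]
    omega

/-! ### Contraction of a finished vertex. -/

theorem branch_contract_of_ne {p s i : ℕ} (hi : i ≠ p) :
    (a.contract p s).branch i = a.branch (reroot p s i) := by
  simp only [contract, if_neg hi, List.append_nil]
  split <;> simp_all

theorem branch_contract_self {p s : ℕ} :
    (a.contract p s).branch p = if a.branch s = [] then [] else a.branch s ++ a.branch p := by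
  simp [contract, reroot_self]

/-- Tokens just move along `reroot`: the part appended at `p` comes after the head. -/
theorem head?_branch_contract (p s i : ℕ) :
    ((a.contract p s).branch i).head? = (a.branch (reroot p s i)).head? := by
  simp only [contract]
  split
  · simp_all
  · next h =>
    obtain ⟨b, l, h⟩ := List.exists_cons_of_ne_nil h
    simp [h]

theorem branch_contract_ne_nil {p s i : ℕ} :
    (a.contract p s).branch i ≠ [] ↔ a.branch (reroot p s i) ≠ [] := by
  rw [ne_eq, ne_eq, ← List.head?_eq_none_iff, head?_branch_contract, List.head?_eq_none_iff]

theorem mem_branch_contract {p s i : ℕ} {v : Fin n} (h : v ∈ (a.contract p s).branch i) :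
    v ∈ a.branch (reroot p s i) ∨ (i = p ∧ v ∈ a.branch p) := by
  simp only [contract] at h
  split at h
  · simp at h
  · rcases List.mem_append.1 h with h | h
    · exact .inl h
    · split at h
      · exact .inr ⟨by assumption, h⟩
      · simp at h

/-- If a child position of `p` is empty, then the positions that survive the replacement of `p`
are exactly the occupied positions other than `p`. -/
theorem Inv.exists_reroot_eq (ha : a.Inv H A N) {p s c : ℕ} (hs : IsChild s p) (hcp : IsChild c p)
    (hsc : s ≠ c) (hc : a.branch c = []) {j : ℕ} (hj : a.branch j ≠ []) (hjp : j ≠ p) :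
    ∃ i, reroot p s i = j := by
  induction j using Nat.strong_induction_on with
  | _ j ih =>
    rcases eq_or_ne j s with rfl | hjs
    · exact ⟨p, reroot_self _ _⟩
    rcases eq_or_ne j 0 with rfl | hj0
    · exact ⟨0, reroot_of_lt (by omega)⟩
    obtain ⟨j', b, hj', hb⟩ := exists_eq_two_mul_add hj0
    have hch : IsChild j j' := by rcases hb with rfl | rfl; exacts [.inl hj', .inr hj']
    rcases eq_or_ne j' p with rfl | hjp'
    -- A child of `p` other than `s` is `c`.
    · have : j = c := by
        rcases hch with h | h <;> rcases hcp with h' | h' <;> rcases hs with h'' | h'' <;> omega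
      exact absurd (this ▸ hc) hj
    obtain ⟨i, hi⟩ := ih j' (by omega) (ha.closed _ _ hch hj) hjp'
    have hne : 2 * i + b ≠ p := by
      intro h
      rw [reroot_of_lt (by omega)] at hi
      omega
    exact ⟨2 * i + b, by rw [reroot_of_ne rfl hb hne, hi]; exact hj'.symm⟩

/-- The only token lost is `x`, and its list is exhausted, so `dead` survives; nothing lies below
the empty position `c`. By `link`, the branch at `s` followed by the branch at `p` is again a chain,
and its last vertex is still linked to the token above `p`. If the position `s` is empty too, `p`
becomes empty. -/
theorem Inv.contract (ha : a.Inv H A N) {p s c : ℕ} (hs : IsChild s p)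
    (hcp : IsChild c p) (hsc : s ≠ c) (hc : a.branch c = []) {x : Fin n}
    (hx : (a.branch p).head? = some x) (hscan : a.scan x = (A x).length) :
    (a.contract p s).Inv H A N := by
  have hinj := reroot_injective hs
  have hne := reroot_ne hs.lt
  have hdis : ∀ i j, i ≠ j → (a.branch (reroot p s i)).Disjoint (a.branch (reroot p s j)) :=
    fun i j hij => ha.disjoint _ _ fun h => hij (hinj h)
  have hlt := hs.lt
  have hup : ∀ u v, (a.contract p s).Up H u v ↔ a.Up H u v := fun u v => Iff.rfl
  refine { ha with
    range := ?_, closed := ?_, nodup := ?_, disjoint := ?_, visited := ?_, chain := ?_, link := ?_,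
    dead := ?_, active_bags := ?_ }
  · intro i hi
    rw [branch_contract_ne_nil] at hi
    exact (le_reroot hlt.le i).trans_lt (ha.range _ hi)
  · intro i d hd h
    rw [branch_contract_ne_nil] at h ⊢
    rcases eq_or_ne d p with rfl | hdp
    · rw [reroot_self] at h
      rw [reroot_of_lt hd.lt]
      exact ha.closed _ _ hd (ha.closed _ _ hs h)
    · exact ha.closed _ _ (reroot_isChild hd hdp) h
  · intro i
    rcases eq_or_ne i p with rfl | hi
    · rw [branch_contract_self]
      split
      · simp
      · exact (ha.nodup s).append (ha.nodup i) (ha.disjoint _ _ hlt.ne')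
    · rw [branch_contract_of_ne hi]; exact ha.nodup _
  · intro i j hij v hi hj
    rcases mem_branch_contract hi with hi | ⟨rfl, hi⟩ <;>
      rcases mem_branch_contract hj with hj | ⟨rfl, hj⟩
    · exact hdis i j hij hi hj
    · exact ha.disjoint _ _ (hne i) hi hj
    · exact ha.disjoint _ _ (hne j).symm hi hj
    · exact hij rfl
  · intro i v hv
    rcases mem_branch_contract hv with h | ⟨rfl, h⟩
    · exact ha.visited _ v h
    · exact ha.visited _ v h
  · intro i
    simp only [Up] at hup ⊢
    rcases eq_or_ne i p with rfl | hi
    · rw [branch_contract_self]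
      split
      · simp
      · exact List.isChain_append.2 ⟨ha.chain s, ha.chain i, fun u hu v hv => ha.link i s hs u hu v hv⟩
    · rw [branch_contract_of_ne hi]; exact ha.chain _
  · intro i d hd u hu v hv
    rw [hup]
    rw [head?_branch_contract] at hv
    rcases eq_or_ne d p with rfl | hdp
    · rw [reroot_of_lt hd.lt] at hv
      refine ha.link i d hd u ?_ v hv
      rw [branch_contract_self] at hu
      split at hu
      · simp at hu
      · rwa [List.getLast?_append_of_ne_nil _ (ne_nil_of_head?_eq hx)] at hu
    · rw [branch_contract_of_ne hdp] at hu
      exact ha.link _ _ (reroot_isChild hd hdp) u hu v hv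
  · intro v hv hact
    by_cases h : ∃ j, (a.branch j).head? = some v
    · obtain ⟨j, hj⟩ := h
      rcases eq_or_ne j p with rfl | hjp
      · rw [hx] at hj
        cases hj
        exact hscan
      · obtain ⟨i, rfl⟩ := ha.exists_reroot_eq hs hcp hsc hc (ne_nil_of_head?_eq hj) hjp
        exact absurd ((head?_branch_contract p s i).trans hj) (hact i)
    · push Not at h
      exact ha.dead v hv h
  · intro i v hi
    rw [head?_branch_contract] at hi
    exact ha.active_bags _ v hi

/-- No token is gained, and `x` is lost because `reroot p s` misses `p`. -/
theorem Inv.potential_contract (ha : a.Inv H A N) {p s : ℕ} (hs : IsChild s p) {x : Fin n}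
    (hx : (a.branch p).head? = some x) :
    (a.contract p s).potential A N + 1 ≤ a.potential A N := by
  have h : ((a.contract p s).active N).card < (a.active N).card := by
    refine Finset.card_lt_card ⟨?_, fun h => ?_⟩
    · intro v hv
      simp only [active, List.mem_toFinset, mem_heads] at hv ⊢
      obtain ⟨i, -, hi⟩ := hv
      rw [head?_branch_contract] at hi
      exact ⟨_, ha.range _ (ne_nil_of_head?_eq hi), hi⟩
    · have hxa : x ∈ a.active N := by
        simp only [active, List.mem_toFinset, mem_heads]
        exact ⟨p, ha.range _ (ne_nil_of_head?_eq hx), hx⟩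
      have := h hxa
      simp only [active, List.mem_toFinset, mem_heads] at this
      obtain ⟨i, -, hi⟩ := this
      rw [head?_branch_contract] at hi
      exact ha.disjoint _ _ (reroot_ne hs.lt i) (mem_of_head?_eq hi) (mem_of_head?_eq hx)
  have h1 : (a.contract p s).unvisited = a.unvisited := rfl
  have h2 : ∑ v, ((A v).length - (a.contract p s).scan v) = ∑ v, ((A v).length - a.scan v) := rfl
  have h3 : (a.contract p s).next = a.next := rfl
  unfold potential
  rw [h1, h2, h3]
  omega

/-- The initial state. -/
def init (n : ℕ) : State n := ⟨fun _ => [], fun _ => none, fun _ => 0, 0, []⟩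

theorem inv_init (H : SimpleGraph (Fin n)) (A : Fin n → List (Fin n)) (N : ℕ) :
    (init n).Inv H A N := by
  constructor <;> simp [init, unvisited]

theorem Inv.isPathDecomposition (ha : a.Inv H A N) (h : ∀ v, a.par v ≠ none) :
    IsPathDecomposition H (a.bags.map List.toFinset) := by
  refine ⟨?_, ?_, ?_⟩
  · intro v
    obtain ⟨B, hB, hv⟩ := (ha.mem_bags v).1 (h v)
    exact ⟨_, List.mem_map_of_mem hB, by simpa⟩
  · intro u v huv
    obtain ⟨B, hB, hu, hv⟩ := ha.edge u v huv (h u) (h v)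
    exact ⟨_, List.mem_map_of_mem hB, by simpa, by simpa⟩
  · intro i j k hij hjk hk v
    simp only [List.length_map] at hk
    simpa using ha.interp i j k hij hjk hk v

theorem Inv.width_le (ha : a.Inv H A N) (hN : 0 < N) :
    width (a.bags.map List.toFinset) + 1 ≤ N := by
  have : width (a.bags.map List.toFinset) ≤ N - 1 := by
    refine PathwidthApprox.width_le fun B hB => ?_
    obtain ⟨l, hl, rfl⟩ := List.mem_map.1 hB
    have := ha.bag_length l hl
    have := List.toFinset_card_le l
    omega
  omega

end State

/-! ### The tree found when all positions are occupied. -/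

theorem joined_of_isChain {V : Type*} {G : SimpleGraph V} {l : List V} (h : l.IsChain G.Adj)
    {a b : V} (ha : a ∈ l) (hb : b ∈ l) : Joined G {x | x ∈ l} a b := by
  induction l generalizing a b with
  | nil => simp at ha
  | cons x l ih =>
    cases l with
    | nil =>
      simp only [List.mem_singleton] at ha hb
      subst ha hb
      exact .refl (by simp)
    | cons y l =>
      have hxy : G.Adj x y := h.rel
      have ih' : ∀ {a b}, a ∈ y :: l → b ∈ y :: l → Joined G {z | z ∈ x :: y :: l} a b :=
        fun ha hb => (ih h.of_cons ha hb).mono fun z hz => List.mem_cons_of_mem _ hz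
      have hx : ∀ {b}, b ∈ y :: l → Joined G {z | z ∈ x :: y :: l} x b := fun hb =>
        (Joined.adj hxy (by simp) (by simp)).trans (ih' (by simp) hb)
      rcases List.mem_cons.1 ha with ha' | ha' <;> rcases List.mem_cons.1 hb with hb' | hb'
      · rw [ha', hb']; exact .refl (by simp)
      · rw [ha']; exact hx hb'
      · rw [hb']; exact (hx ha').symm
      · exact ih' ha' hb'

theorem exists_walk_support_eq {V : Type*} {G : SimpleGraph V} {b e : V} {l : List V}
    (h : (l ++ [e]).IsChain G.Adj) (hb : l.head? = some b) :
    ∃ w : G.Walk b e, w.support = l ++ [e] := by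
  induction l generalizing b with
  | nil => simp at hb
  | cons x l ih =>
    simp only [List.head?_cons, Option.some.injEq] at hb
    subst hb
    cases l with
    | nil =>
      have hxe : G.Adj x e := by simpa using h
      exact ⟨.cons hxe .nil, by simp⟩
    | cons y l =>
      have hxy : G.Adj x y := h.rel
      obtain ⟨w, hw⟩ := ih (b := y) h.of_cons rfl
      exact ⟨.cons hxy w, by simp [hw]⟩

namespace State

variable {n : ℕ} {H : SimpleGraph (Fin n)} {A : Fin n → List (Fin n)} {N h : ℕ} {a : State n}

/-- The branches are disjoint connected sets, and `link` gives an edge between the branches of a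
child and its parent, so contracting each branch exhibits the tree as a minor. -/
theorem Inv.pathwidth_le (ha : a.Inv H A N) (hfull : ∀ i < 2 ^ h - 1, a.branch i ≠ []) :
    pathwidth (binaryTree h) ≤ pathwidth H := by
  classical
  let f : Fin n → Option (Fin (2 ^ h - 1)) := fun w =>
    if hw : ∃ i : Fin (2 ^ h - 1), w ∈ a.branch i then some hw.choose else none
  have hf : ∀ w i, f w = some i ↔ w ∈ a.branch i := by
    intro w i
    have huniq : ∀ j : Fin (2 ^ h - 1), w ∈ a.branch i → w ∈ a.branch j → i = j := by
      intro j hi hj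
      by_contra hij
      exact ha.disjoint i j (fun h => hij (Fin.ext h)) hi hj
    by_cases hw : ∃ i : Fin (2 ^ h - 1), w ∈ a.branch i
    · simp only [f, dif_pos hw, Option.some.injEq]
      constructor
      · rintro rfl; exact hw.choose_spec
      · intro hi; exact (huniq _ hi hw.choose_spec).symm
    · simp only [f, dif_neg hw, reduceCtorEq, false_iff]
      exact fun h => hw ⟨i, h⟩
  have hadj : ∀ c p : Fin (2 ^ h - 1), IsChild c p →
      ∃ u ∈ a.branch c, ∃ v ∈ a.branch p, H.Adj u v := by
    intro c p hcp
    obtain ⟨u, hu⟩ := Option.isSome_iff_exists.1 (List.getLast?_isSome.2 (hfull c c.2))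
    obtain ⟨v, hv⟩ := Option.isSome_iff_exists.1 (List.isSome_head?.2 (hfull p p.2))
    exact ⟨u, List.mem_of_getLast? hu, v, mem_of_head?_eq hv, (ha.link p c hcp u hu v hv).2⟩
  refine pathwidth_le_of_minor f ?_ ?_ ?_
  · intro i u v hu hv
    rw [hf] at hu hv
    have hch : (a.branch i).IsChain H.Adj := (ha.chain i).imp fun _ _ h => h.2
    exact (joined_of_isChain hch hu hv).mono fun x hx => (hf x i).2 hx
  · intro i
    obtain ⟨v, hv⟩ := List.exists_mem_of_ne_nil _ (hfull i i.2)
    exact ⟨v, (hf v i).2 hv⟩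
  · intro p c hpc
    rcases binaryTree_adj.1 hpc with hpc | hpc
    · obtain ⟨u, hu, v, hv, huv⟩ := hadj c p hpc
      exact ⟨v, u, (hf _ _).2 hv, (hf _ _).2 hu, huv.symm⟩
    · obtain ⟨u, hu, v, hv, huv⟩ := hadj p c hpc
      exact ⟨u, v, (hf _ _).2 hu, (hf _ _).2 hv, huv⟩

/-- The tokens are the images of the tree vertices. The path from a child to its parent runs along
the branch of the child and ends at the parent's token; the branch at the root contributes only its
head. -/
theorem Inv.exists_homeoEmbedding (ha : a.Inv H A N)
    (hfull : ∀ i < 2 ^ h - 1, a.branch i ≠ []) :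
    ∃ E : HomeoEmbedding (binaryTree h) H,
      (∀ i : Fin (2 ^ h - 1), (a.branch i).head? = some (E.toFun i)) ∧
      ∀ (p i : Fin (2 ^ h - 1)) (hpi : (binaryTree h).Adj p i), p < i →
        (E.path p i hpi).support = E.toFun p :: (a.branch i).reverse := by
  have hex : ∀ i : Fin (2 ^ h - 1), ∃ v, (a.branch i).head? = some v := fun i =>
    Option.isSome_iff_exists.1 (List.isSome_head?.2 (hfull i i.2))
  choose f hf using hex
  have hfm : ∀ i : Fin (2 ^ h - 1), f i ∈ a.branch i := fun i => mem_of_head?_eq (hf i)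
  have huniq : ∀ (i j : Fin (2 ^ h - 1)) (w : Fin n), w ∈ a.branch i → w ∈ a.branch j → i = j := by
    intro i j w hi hj
    by_contra hij
    exact ha.disjoint i j (fun h => hij (Fin.ext h)) hi hj
  have hW : ∀ c p : Fin (2 ^ h - 1), IsChild c p →
      ∃ w : H.Walk (f c) (f p), w.support = a.branch c ++ [f p] := by
    intro c p hcp
    refine exists_walk_support_eq (List.isChain_append.2 ⟨?_, by simp, ?_⟩) (hf c)
    · exact (ha.chain c).imp fun _ _ h => h.2
    · intro u hu v hv
      simp only [List.head?_cons, Option.mem_def, Option.some.injEq] at hv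
      subst hv
      exact (ha.link p c hcp u hu _ (hf p)).2
  choose W hWs using hW
  have hWp : ∀ c p hcp, (W c p hcp).IsPath := by
    intro c p hcp
    rw [SimpleGraph.Walk.isPath_def, hWs]
    refine (ha.nodup c).append (by simp) ?_
    intro w hw hw'
    simp only [List.mem_singleton] at hw'
    subst hw'
    have := huniq c p _ hw (hfm p)
    have := hcp.lt
    omega
  have hch : ∀ {u v : Fin (2 ^ h - 1)}, (binaryTree h).Adj u v → v < u → IsChild u v := by
    intro u v huv hlt
    rcases binaryTree_adj.1 huv with h | h
    · omega
    · exact h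
  have hch' : ∀ {u v : Fin (2 ^ h - 1)}, (binaryTree h).Adj u v → ¬ v < u → IsChild v u := by
    intro u v huv hlt
    rcases binaryTree_adj.1 huv with h | h
    · exact h
    · omega
  -- The child is the larger end. One walk is kept per edge and reversed for the other direction, so
  -- that `path_symm` holds.
  let path : ∀ u v : Fin (2 ^ h - 1), (binaryTree h).Adj u v → H.Walk (f u) (f v) :=
    fun u v huv => if hlt : v < u then W u v (hch huv hlt) else (W v u (hch' huv hlt)).reverse
  have hpath : ∀ u v huv, ∃ c p : Fin (2 ^ h - 1), IsChild c p ∧ s(u, v) = s(c, p) ∧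
      ∀ w ∈ (path u v huv).support, w ∈ a.branch c ∨ w = f p := by
    intro u v huv
    by_cases hlt : v < u
    · refine ⟨u, v, hch huv hlt, rfl, fun w hw => ?_⟩
      simpa [path, dif_pos hlt, hWs] using hw
    · refine ⟨v, u, hch' huv hlt, Sym2.eq_swap, fun w hw => ?_⟩
      simpa [path, dif_neg hlt, hWs, or_comm] using hw
  refine ⟨⟨f, ?_, path, ?_, ?_, ?_, ?_⟩, hf, ?_⟩
  · intro i j hij
    exact huniq i j _ (hfm i) (hij ▸ hfm j)
  · intro u v huv
    by_cases hlt : v < u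
    · simpa [path, dif_pos hlt] using hWp _ _ _
    · simpa [path, dif_neg hlt] using hWp _ _ _
  · intro u v huv
    have hne : u ≠ v := huv.ne
    by_cases hlt : v < u
    · have : ¬ u < v := by omega
      simp [path, dif_pos hlt, dif_neg this]
    · have : u < v := by omega
      simp [path, dif_neg hlt, dif_pos this]
  · intro u v huv i hi
    obtain ⟨c, p, -, hs, hm⟩ := hpath u v huv
    have hi' : i = c ∨ i = p := by
      rcases hm _ hi with h | h
      · exact .inl (huniq _ _ _ (hfm i) h)
      · exact .inr (huniq _ _ _ (hfm i) (h ▸ hfm p))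
    have : i ∈ s(u, v) := by rw [hs]; simpa using hi'
    simpa using this
  · intro u v huv x y hxy hne w hw hw'
    obtain ⟨c, p, hcp, hs, hm⟩ := hpath u v huv
    obtain ⟨c', p', hcp', hs', hm'⟩ := hpath x y hxy
    rw [hs, hs'] at hne ⊢
    -- A tree edge is determined by its lower end.
    have hcc : c ≠ c' := by
      rintro rfl
      have : p = p' := Fin.ext (hcp.parent_eq hcp')
      exact hne (by rw [this])
    rcases hm w hw with h1 | h1 <;> rcases hm' w hw' with h2 | h2
    · exact absurd (huniq _ _ _ h1 h2) hcc
    · have : c = p' := huniq _ _ _ h1 (h2 ▸ hfm p')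
      exact ⟨p', by simp [this], by simp, h2.symm⟩
    · have : c' = p := huniq _ _ _ h2 (h1 ▸ hfm p)
      exact ⟨p, by simp, by simp [this], h1.symm⟩
    · have : p = p' := huniq _ _ _ (h1 ▸ hfm p) (h2 ▸ hfm p')
      exact ⟨p, by simp, by simp [this], h1.symm⟩
  · intro p i hpi hlt
    have : ¬ i < p := by omega
    simp [path, dif_neg this, hWs]

end State

/-! ### Reasoning about programs -/

section Calculus

variable {W : ℕ} {s : Store} {Q Q' : Store → Prop} {p q : Program} {K K' : ℕ}

@[simp] theorem run_const_reg (s : Store) (r c q : ℕ) :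
    (Op.run s (.const r c)).reg q = if q = r then c else s.reg q := by
  simp [Op.run, Op.value, Function.update_apply]

@[simp] theorem run_add_reg (s : Store) (r a b q : ℕ) :
    (Op.run s (.add r a b)).reg q = if q = r then s.reg a + s.reg b else s.reg q := by
  simp [Op.run, Op.value, Function.update_apply]

@[simp] theorem run_sub_reg (s : Store) (r a b q : ℕ) :
    (Op.run s (.sub r a b)).reg q = if q = r then s.reg a - s.reg b else s.reg q := by
  simp [Op.run, Op.value, Function.update_apply]

@[simp] theorem run_load_reg (s : Store) (r A i q : ℕ) :
    (Op.run s (.load r A i)).reg q = if q = r then s.arr A (s.reg i) else s.reg q := by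
  simp [Op.run, Op.value, Function.update_apply]

@[simp] theorem run_store_reg (s : Store) (A i a : ℕ) :
    (Op.run s (.store A i a)).reg = s.reg := rfl

@[simp] theorem run_const_arr (s : Store) (r c : ℕ) : (Op.run s (.const r c)).arr = s.arr := rfl

@[simp] theorem run_add_arr (s : Store) (r a b : ℕ) : (Op.run s (.add r a b)).arr = s.arr := rfl

@[simp] theorem run_sub_arr (s : Store) (r a b : ℕ) : (Op.run s (.sub r a b)).arr = s.arr := rfl

@[simp] theorem run_load_arr (s : Store) (r A i : ℕ) : (Op.run s (.load r A i)).arr = s.arr := rfl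

@[simp] theorem run_store_arr (s : Store) (A i a B j : ℕ) :
    (Op.run s (.store A i a)).arr B j =
      if B = A ∧ j = s.reg i then s.reg a else s.arr B j := by
  by_cases hB : B = A
  · subst hB
    simp [Op.run, Op.value, Function.update_apply]
  · simp [Op.run, hB]

/-- The program `p`, started in `s`, halts after at most `K` steps in a memory that satisfies
`Q`. -/
def Runs (W : ℕ) (p : Program) (s : Store) (K : ℕ) (Q : Store → Prop) : Prop :=
  ∃ s' k, Exec W p s s' k ∧ k ≤ K ∧ Q s'

theorem Runs.mono (h : Runs W p s K Q) (hK : K ≤ K') (hQ : ∀ s', Q s' → Q' s') :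
    Runs W p s K' Q' := by
  obtain ⟨s', k, he, hk, hq⟩ := h
  exact ⟨s', k, he, hk.trans hK, hQ _ hq⟩

theorem Runs.seq (h : Runs W p s K Q) (h' : ∀ s', Q s' → Runs W q s' K' Q') :
    Runs W (.seq p q) s (K + K') Q' := by
  obtain ⟨s', k, he, hk, hq⟩ := h
  obtain ⟨s'', k', he', hk', hq'⟩ := h' s' hq
  exact ⟨s'', k + k', .seq he he', by omega, hq'⟩

theorem Runs.ite {b : Test} (h : b.holds s → Runs W p s K Q) (h' : ¬ b.holds s → Runs W q s K Q) :
    Runs W (.ite b p q) s (K + 1) Q := by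
  by_cases hb : b.holds s
  · obtain ⟨s', k, he, hk, hq⟩ := h hb
    exact ⟨s', k + 1, .ite_true hb he, by omega, hq⟩
  · obtain ⟨s', k, he, hk, hq⟩ := h' hb
    exact ⟨s', k + 1, .ite_false hb he, by omega, hq⟩

/-- A loop whose invariant is indexed by a bound on the number of remaining iterations. -/
theorem Runs.loop {b : Test} (I : ℕ → Store → Prop)
    (h : ∀ m s, I m s → b.holds s → Runs W p s K fun s' => ∃ m' < m, I m' s') {m : ℕ}
    (hs : I m s) :
    Runs W (.while b p) s (m * (K + 1) + 1) fun s' => ∃ m' ≤ m, I m' s' ∧ ¬ b.holds s' := by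
  induction m using Nat.strong_induction_on generalizing s with
  | _ m ih =>
    by_cases hb : b.holds s
    · obtain ⟨s', k, he, hk, m', hm', hs'⟩ := h m s hs hb
      obtain ⟨s'', k', he', hk', m'', hm'', hs''⟩ := ih m' hm' hs'
      refine ⟨s'', k + k' + 1, .while_true hb he he', ?_, m'', by omega, hs''⟩
      have : (m' + 1) * (K + 1) ≤ m * (K + 1) := Nat.mul_le_mul_right _ hm'
      rw [Nat.add_mul] at this
      omega
    · exact ⟨s, 1, .while_false hb, by omega, m, le_rfl, hs, hb⟩

/-- The weakest precondition of a program without loops. -/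
def Program.wp (W : ℕ) : Program → Store → (Store → Prop) → Prop
  | .skip, s, Q => Q s
  | .op o, s, Q => o.value s ≤ W ∧ Q (o.run s)
  | .seq p q, s, Q => p.wp W s fun s' => q.wp W s' Q
  | .ite b p q, s, Q => (b.holds s → p.wp W s Q) ∧ (¬ b.holds s → q.wp W s Q)
  | .while _ _, _, _ => False

/-- A bound on the number of steps of a program without loops. -/
def Program.cost : Program → ℕ
  | .skip => 0
  | .op _ => 1
  | .seq p q => p.cost + q.cost
  | .ite _ p q => p.cost + q.cost + 1
  | .while _ _ => 0

theorem Program.wp_mono (h : p.wp W s Q) (hQ : ∀ s', Q s' → Q' s') : p.wp W s Q' := by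
  induction p generalizing s Q Q' with
  | skip => exact hQ _ h
  | op o => exact ⟨h.1, hQ _ h.2⟩
  | seq p q ihp ihq => exact ihp h fun s' hs' => ihq hs' hQ
  | ite b p q ihp ihq => exact ⟨fun hb => ihp (h.1 hb) hQ, fun hb => ihq (h.2 hb) hQ⟩
  | _ => exact h

theorem Program.wp.runs (h : p.wp W s Q) : Runs W p s p.cost Q := by
  induction p generalizing s Q with
  | skip => exact ⟨s, 0, .skip s, le_rfl, h⟩
  | op o => exact ⟨_, 1, .op o s h.1, le_rfl, h.2⟩
  | seq p q ihp ihq => exact (ihp h).seq fun s' hs' => ihq hs'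
  | ite b p q ihp ihq =>
    exact Runs.ite (fun hb => (ihp (h.1 hb)).mono (by omega) fun _ => id)
      fun hb => (ihq (h.2 hb)).mono (by omega) fun _ => id
  | _ => exact h.elim

end Calculus

/-! ### Lists written one after the other -/

section Flatten

variable {α : Type*} {L : List (List α)} {l : List α} {i : ℕ}

theorem length_flatten_take_succ (h : L[i]? = some l) :
    (L.take (i + 1)).flatten.length = (L.take i).flatten.length + l.length := by
  rw [List.take_add_one, h]
  simp

theorem getElem?_flatten_take (h : L[i]? = some l) {k : ℕ} (hk : k < l.length) :
    L.flatten[(L.take i).flatten.length + k]? = l[k]? := by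
  obtain ⟨hi, h⟩ := List.getElem?_eq_some_iff.1 h
  have hL : L.flatten = (L.take i).flatten ++ (L.drop i).flatten := by
    rw [← List.flatten_append, List.take_append_drop]
  rw [hL, List.getElem?_append_right (by omega), List.drop_eq_getElem_cons hi, h, List.flatten_cons,
    Nat.add_sub_cancel_left, List.getElem?_append_left hk]

theorem length_flatten_take_le (i : ℕ) : (L.take i).flatten.length ≤ L.flatten.length := by
  conv_rhs => rw [← List.take_append_drop i L, List.flatten_append, List.length_append]
  omega

theorem length_flatten_le {N : ℕ} (h : ∀ l ∈ L, l.length ≤ N) :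
    L.flatten.length ≤ L.length * N := by
  induction L with
  | nil => simp
  | cons l L ih =>
    have h1 := h l (by simp)
    have h2 := ih fun l hl => h l (by simp [hl])
    simp only [List.flatten_cons, List.length_append, List.length_cons, Nat.add_mul, one_mul]
    omega

end Flatten

/-! ### The program

Registers: `0` number of vertices, later the result; `1` number of bags; `2` zero; `3` one; `4` next
candidate for a root; `5` output position; `6` status; `7` to `11` auxiliary; `i + 20` the vertex at
the position `i` of the guest tree. Arrays `4` and `5` hold scan pointers and forest parents. The
vertex `v` is represented by `v + 1` in the registers `i + 20`, as an index to the arrays `4` and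
`5`, and in the array `5`; there `0` means that there is no vertex. -/

/-- The number that represents a vertex. -/
def code {n : ℕ} : Option (Fin n) → ℕ
  | none => 0
  | some v => v + 1

/-- Append the vertices at the first `k` positions to the output. -/
def writeTokens : ℕ → Program
  | 0 => .skip
  | k + 1 => .seq (writeTokens k) (.ite (.eq (k + 20) 2) .skip
      (.seq (.op (.sub 11 (k + 20) 3)) (.seq (.op (.store 3 5 11)) (.op (.add 5 5 3)))))

/-- Put the vertex in register `8`, found from the vertex in register `7`, at the position `c`, and
write a bag. -/
def placeProgram (N c : ℕ) : Program :=
  .seq (.op (.sub 11 8 3)) <| .seq (.op (.load 9 0 11)) <| .seq (.op (.store 4 8 9)) <|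
  .seq (.op (.store 5 8 7)) <| .seq (.op (.add (c + 20) 8 2)) <| .seq (writeTokens N) <|
  .seq (.op (.add 1 1 3)) (.op (.store 2 1 5))

/-- Replace the vertex at the position `p` by the subtree at `s`, at the first `k` positions. -/
def contractProgram (N p s : ℕ) : ℕ → Program
  | 0 => .skip
  | k + 1 => .seq (contractProgram N p s k)
      (if reroot p s k < N then .op (.add (k + 20) (reroot p s k + 20) 2)
        else .op (.const (k + 20) 0))

/-- Treat the empty root position. -/
def rootProgram (N : ℕ) : Program :=
  .ite (.eq 4 0) (.op (.const 6 2)) <| .seq (.op (.add 7 4 3)) <| .seq (.op (.add 8 7 2)) <|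
  .seq (.op (.add 4 4 3)) <| .seq (.op (.load 11 5 8)) <| .ite (.eq 11 2) (placeProgram N 0) .skip

/-- Treat the empty position `c` with parent `p` and sibling `s`. -/
def childProgram (N c p s : ℕ) : Program :=
  .seq (.op (.add 7 (p + 20) 2)) <| .seq (.op (.load 9 4 7)) <| .seq (.op (.load 10 0 7)) <|
  .ite (.lt 9 10)
    (.seq (.op (.load 8 1 9)) <| .seq (.op (.add 8 8 3)) <| .seq (.op (.add 9 9 3)) <|
      .seq (.op (.store 4 7 9)) <| .seq (.op (.load 11 5 8)) <|
      .ite (.eq 11 2) (placeProgram N c) .skip)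
    (contractProgram N p s N)

/-- Find an empty position among the last `k` of `N` positions and treat it. -/
def searchProgram (N : ℕ) : ℕ → Program
  | 0 => .op (.const 6 1)
  | k + 1 => .ite (.eq (N - (k + 1) + 20) 2)
      (if N - (k + 1) = 0 then rootProgram N else
        childProgram N (N - (k + 1)) ((N - (k + 1) - 1) / 2)
          -- The sibling: the two children of `p` add up to `4 * p + 3`.
          (4 * ((N - (k + 1) - 1) / 2) + 3 - (N - (k + 1))))
      (searchProgram N k)

/-! ### Correctness of the main loop -/

/-- The memory represents the state. -/
structure Represents {n : ℕ} (L : List (List ℕ)) (N : ℕ) (a : State n) (s : Store) : Prop where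
  order : s.reg 0 = n
  length : s.reg 1 = a.bags.length
  zero : s.reg 2 = 0
  one : s.reg 3 = 1
  next : s.reg 4 = a.next
  position : s.reg 5 = a.bags.flatten.length
  token : ∀ i < N, s.reg (i + 20) = code (a.branch i).head?
  start : ∀ i ≤ n, s.arr 0 i = (L.take i).flatten.length
  adj : ∀ j w, L.flatten[j]? = some w → s.arr 1 j = w
  bag_start : ∀ i ≤ a.bags.length, s.arr 2 i = (a.bags.take i).flatten.length
  bag : ∀ (j : ℕ) (v : Fin n), a.bags.flatten[j]? = some v → s.arr 3 j = v
  pointer : ∀ v : Fin n, a.par v ≠ none → s.arr 4 (v + 1) = (L.take v).flatten.length + a.scan v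
  par : ∀ v : Fin n, s.arr 5 (v + 1) = code (a.par v)

section

variable {n N W : ℕ} {L : List (List ℕ)} {s : Store} {a : State n}

theorem code_le (v : Option (Fin n)) : code v ≤ n := by
  cases v with
  | none => simp [code]
  | some v => simp only [code]; omega

theorem heads_succ {α : Type*} (k : ℕ) (f : ℕ → List α) :
    heads (k + 1) f = heads k f ++ (f k).head?.toList := by
  rw [heads, List.range_succ, List.filterMap_append, ← heads]
  cases h : (f k).head? <;> simp [h]

/-- The machine counterpart of `heads`. The family `f` is arbitrary since it will be the family of
branches after a placement, before the bag has been recorded. -/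
theorem wp_writeTokens {f : ℕ → List (Fin n)} {k : ℕ} (hk : k ≤ N)
    (hf : ∀ i < N, s.reg (i + 20) = code (f i).head?) (h2 : s.reg 2 = 0) (h3 : s.reg 3 = 1)
    (hW : s.reg 5 + N ≤ W) (hn : n ≤ W) :
    (writeTokens k).wp W s fun s' =>
      s'.reg 5 = s.reg 5 + (heads k f).length ∧
      (∀ r, r ≠ 5 → r ≠ 11 → s'.reg r = s.reg r) ∧
      (∀ (j : ℕ) (v : Fin n), (heads k f)[j]? = some v → s'.arr 3 (s.reg 5 + j) = v) ∧
      (∀ j < s.reg 5, s'.arr 3 j = s.arr 3 j) ∧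
      (∀ B, B ≠ 3 → s'.arr B = s.arr B) := by
  induction k with
  | zero => simp [writeTokens, Program.wp, heads]
  | succ k ih =>
    rw [writeTokens, Program.wp]
    refine Program.wp_mono (ih (by omega)) fun s' hs' => ?_
    obtain ⟨h5, hreg, hnew, hold, harr⟩ := hs'
    have htok : s'.reg (k + 20) = code (f k).head? := by
      rw [hreg _ (by omega) (by omega)]; exact hf k hk
    have h2' : s'.reg 2 = 0 := by rw [hreg 2 (by simp) (by simp), h2]
    have h3' : s'.reg 3 = 1 := by rw [hreg 3 (by simp) (by simp), h3]
    have hlen := length_heads_le k f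
    refine ⟨fun hb => ?_, fun hb => ?_⟩
    · have : (f k).head? = none := by
        simp only [Test.holds, h2', htok] at hb
        cases h : (f k).head? <;> simp_all [code]
      simp only [Program.wp, heads_succ, this, Option.toList_none, List.append_nil]
      exact ⟨h5, hreg, hnew, hold, harr⟩
    · obtain ⟨v, hv⟩ : ∃ v, (f k).head? = some v := by
        simp only [Test.holds, h2', htok] at hb
        cases h : (f k).head? <;> simp_all [code]
      have hvn := v.2
      simp only [Program.wp, heads_succ, hv, Option.toList_some, Op.value, htok, code, h3',
        run_sub_reg, run_store_reg, if_true, if_false, Nat.reduceEqDiff, h5]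
      refine ⟨by omega, by omega, by omega, ?_, ?_, ?_, ?_, ?_⟩
      · simp [h3', h5]; omega
      · intro r hr hr'
        simp only [run_add_reg, if_neg hr, run_store_reg, run_sub_reg, if_neg hr']
        exact hreg r hr hr'
      · intro j w hj
        simp only [run_add_arr, run_store_arr, run_sub_reg, run_sub_arr, if_true, htok, hv, code,
          h3', Nat.add_sub_cancel, true_and, Nat.reduceEqDiff, if_false, h5, Nat.add_left_cancel_iff]
        rcases lt_trichotomy j (heads k f).length with hlt | rfl | hlt
        · rw [List.getElem?_append_left hlt] at hj
          rw [if_neg (by omega)]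
          exact hnew j w hj
        · rw [List.getElem?_append_right le_rfl] at hj
          simp at hj
          simp [hj]
        · rw [List.getElem?_eq_none (by simp; omega)] at hj
          simp at hj
      · intro j hj
        simp only [run_add_arr, run_store_arr, run_sub_reg, run_sub_arr, true_and, Nat.reduceEqDiff,
          if_false, h5]
        rw [if_neg (by omega)]
        exact hold j hj
      · intro B hB
        funext j
        simp only [run_add_arr, run_store_arr, run_sub_arr]
        rw [if_neg (by simp [hB]), harr B hB]

/-- The source of a position is that position or a later one (`le_reroot`), so copying in increasing
order never reads an overwritten register. Sources from `N` on count as empty. -/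
theorem wp_contractProgram {p t k : ℕ} (hpt : p ≤ t) (hk : k ≤ N) (h2 : s.reg 2 = 0)
    (hW : ∀ i < N, s.reg (i + 20) ≤ W) :
    (contractProgram N p t k).wp W s fun s' =>
      (∀ i < k, s'.reg (i + 20) = if reroot p t i < N then s.reg (reroot p t i + 20) else 0) ∧
      (∀ r, r < 20 ∨ k + 20 ≤ r → s'.reg r = s.reg r) ∧ s'.arr = s.arr := by
  induction k with
  | zero => simp [contractProgram, Program.wp]
  | succ k ih =>
    rw [contractProgram, Program.wp]
    refine Program.wp_mono (ih (by omega)) fun s' hs' => ?_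
    obtain ⟨htok, hreg, harr⟩ := hs'
    have h2' : s'.reg 2 = 0 := by rw [hreg 2 (by simp), h2]
    have hle := le_reroot hpt k
    have hsrc : s'.reg (reroot p t k + 20) = s.reg (reroot p t k + 20) := hreg _ (by omega)
    split
    · next hlt =>
      simp only [Program.wp, Op.value, h2', hsrc, add_zero]
      refine ⟨hW _ hlt, ?_, ?_, by simpa using harr⟩
      · intro i hi
        simp only [run_add_reg, Nat.add_right_cancel_iff, h2', hsrc, add_zero]
        split
        · next h => rw [h, if_pos hlt]
        · exact htok i (by omega)
      · intro r hr
        rw [run_add_reg, if_neg (by omega)]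
        exact hreg r (by omega)
    · next hlt =>
      simp only [Program.wp, Op.value]
      refine ⟨by omega, ?_, ?_, by simpa using harr⟩
      · intro i hi
        simp only [run_const_reg, Nat.add_right_cancel_iff]
        split
        · next h => rw [h, if_neg hlt]
        · exact htok i (by omega)
      · intro r hr
        rw [run_const_reg, if_neg (by omega)]
        exact hreg r (by omega)

/-- The scan pointer of `y` is set to the start of its list only now, when `y` becomes visited; this
is why `Represents.pointer` is restricted to visited vertices. -/
theorem wp_placeProgram (hs : Represents L N a s) {c : ℕ} {x y : Fin n}
    (h7 : s.reg 7 = x + 1) (h8 : s.reg 8 = y + 1) (hscan : a.scan y = 0)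
    (hn : n ≤ W) (hL : L.flatten.length ≤ W) (hpos : a.bags.flatten.length + N ≤ W)
    (hlen : a.bags.length + 1 ≤ W) :
    (placeProgram N c).wp W s fun s' =>
      Represents L N (a.place N c x y) s' ∧ s'.reg 6 = s.reg 6 := by
  have hx := x.2
  have hy := y.2
  have hstart := hs.start y hy.le
  have hzero := hs.zero
  have hone := hs.one
  have hLy : (L.take y).flatten.length ≤ L.flatten.length := length_flatten_take_le _
  simp only [placeProgram, Program.wp, Op.value, run_sub_reg, run_load_reg, run_store_reg,
    run_add_reg, run_sub_arr, if_true, if_false, Nat.reduceEqDiff, h7, h8, hzero,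
    hone, Nat.add_sub_cancel, hstart, add_zero]
  refine ⟨by omega, by omega, by omega, by omega, by omega, ?_⟩
  generalize hs₁ : Op.run _ (.add (c + 20) 8 2) = s₁
  have hreg : ∀ r, r ≠ 9 → r ≠ 11 → r ≠ c + 20 → s₁.reg r = s.reg r := by
    intro r h9 h11 hr
    rw [← hs₁]
    simp [h9, h11, hr]
  have htok : ∀ i < N, s₁.reg (i + 20) = code ((a.place N c x y).branch i).head? := by
    intro i hi
    simp only [State.place, Function.update_apply]
    split
    · next h =>
      rw [← hs₁]
      simp [h, h8, hzero, code]
    · next h =>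
      rw [hreg _ (by omega) (by omega) (by omega)]
      exact hs.token i hi
  have harr : ∀ B, B ≠ 4 → B ≠ 5 → s₁.arr B = s.arr B := by
    intro B h4 h5
    funext j
    rw [← hs₁]
    simp [h4, h5]
  have harr4 : ∀ j, s₁.arr 4 j = if j = y + 1 then (L.take y).flatten.length else s.arr 4 j := by
    intro j
    rw [← hs₁]
    simp [h8, hone, hstart]
  have harr5 : ∀ j, s₁.arr 5 j = if j = y + 1 then (x : ℕ) + 1 else s.arr 5 j := by
    intro j
    rw [← hs₁]
    simp [h8, h7]
  have hr : ∀ r, r < 9 → s₁.reg r = s.reg r := fun r h => hreg r (by omega) (by omega) (by omega)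
  have h5 : s₁.reg 5 = a.bags.flatten.length := by rw [hr 5 (by simp), hs.position]
  have hpost := wp_writeTokens (W := W) (k := N) le_rfl htok (by rw [hr 2 (by simp), hzero])
    (by rw [hr 3 (by simp), hone]) (by rw [h5]; exact hpos) hn
  refine Program.wp_mono hpost fun s₂ ⟨hp, hreg₂, hnew, hold, harr₂⟩ => ?_
  have hr₂ : ∀ r, r < 9 → r ≠ 5 → s₂.reg r = s.reg r := fun r h h' => by
    rw [hreg₂ r h' (by omega), hr r h]
  have hH : heads N (a.place N c x y).branch = heads N (Function.update a.branch c [y]) := rfl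
  have hbags : (a.place N c x y).bags = a.bags ++ [heads N (a.place N c x y).branch] := rfl
  rw [h5] at hp hnew hold
  have hl := length_heads_le N (a.place N c x y).branch
  simp only [hr₂ 1 (by simp) (by simp), hs.length, hr₂ 3 (by simp) (by simp), hone, hp]
  refine ⟨hlen, by omega, ⟨?_, ?_, ?_, ?_, ?_, ?_, ?_, ?_, ?_, ?_, ?_, ?_, ?_⟩, ?_⟩
  · simp [hr₂, hs.order]
  · simp [hr₂, hs.length, hone, hbags]
  · simp [hr₂, hzero]
  · simp [hr₂, hone]
  · simp [hr₂, hs.next, State.place]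
  · simp [hp, hbags]
  · intro i hi
    rw [← htok i hi, ← hreg₂ (i + 20) (by omega) (by omega)]
    simp
  · intro i hi
    rw [run_store_arr, if_neg (by simp), run_add_arr, harr₂ 0 (by simp), harr 0 (by simp) (by simp)]
    exact hs.start i hi
  · intro j w hj
    rw [run_store_arr, if_neg (by simp), run_add_arr, harr₂ 1 (by simp), harr 1 (by simp) (by simp)]
    exact hs.adj j w hj
  · intro i hi
    simp only [hbags, List.length_append, List.length_singleton] at hi ⊢
    simp only [run_store_arr, run_add_reg, true_and, if_true, hr₂ 1 (by simp) (by simp), hs.length,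
      hr₂ 3 (by simp) (by simp), hone, run_add_arr, harr₂ 2 (by simp), harr 2 (by simp) (by simp), hp,
      Nat.reduceEqDiff, if_false]
    split
    · next h =>
      rw [List.take_of_length_le (by simp [h])]
      simp
    · next h =>
      rw [List.take_append_of_le_length (by omega)]
      exact hs.bag_start i (by omega)
  · intro j v hj
    rw [run_store_arr, if_neg (by simp), run_add_arr]
    rw [hbags] at hj
    simp only [List.flatten_append, List.flatten_cons, List.flatten_nil, List.append_nil] at hj
    rcases lt_or_ge j a.bags.flatten.length with hlt | hge
    · rw [List.getElem?_append_left hlt] at hj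
      rw [hold j hlt, harr 3 (by simp) (by simp)]
      exact hs.bag j v hj
    · rw [List.getElem?_append_right hge] at hj
      have := hnew _ v hj
      rwa [Nat.add_sub_cancel' hge] at this
  · intro v hv
    rw [run_store_arr, if_neg (by simp), run_add_arr, harr₂ 4 (by simp), harr4]
    simp only [State.place, Nat.add_right_cancel_iff, Fin.val_inj] at hv ⊢
    split
    · next h => rw [h, hscan, add_zero]
    · next h =>
      rw [Function.update_of_ne h] at hv
      exact hs.pointer v hv
  · intro v
    rw [run_store_arr, if_neg (by simp), run_add_arr, harr₂ 5 (by simp), harr5]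
    simp only [State.place, Nat.add_right_cancel_iff, Fin.val_inj, Function.update_apply]
    split
    · rfl
    · exact hs.par v
  · simp [hr₂]

end

section

variable {n N W : ℕ} {L : List (List ℕ)} {s : Store} {a : State n}
  {H : SimpleGraph (Fin n)} {A : Fin n → List (Fin n)}

/-! ### One step of the main loop. -/

theorem code_eq_zero {v : Option (Fin n)} : code v = 0 ↔ v = none := by
  cases v <;> simp [code]

/-- This covers the steps that change nothing but auxiliary registers, the root candidate and the
scan pointers. -/
theorem Represents.congr (hs : Represents L N a s) {s' : Store} {b : State n}
    (hbranch : b.branch = a.branch) (hbags : b.bags = a.bags) (hpar : b.par = a.par)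
    (hreg : ∀ r, r ≠ 4 → (r < 6 ∨ 20 ≤ r) → s'.reg r = s.reg r) (hnext : s'.reg 4 = b.next)
    (harr : ∀ B, B ≠ 4 → s'.arr B = s.arr B)
    (hptr : ∀ v : Fin n, a.par v ≠ none →
      s'.arr 4 (v + 1) = (L.take v).flatten.length + b.scan v) :
    Represents L N b s' where
  order := by rw [hreg 0 (by simp) (by simp), hs.order]
  length := by rw [hreg 1 (by simp) (by simp), hs.length, hbags]
  zero := by rw [hreg 2 (by simp) (by simp), hs.zero]
  one := by rw [hreg 3 (by simp) (by simp), hs.one]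
  next := hnext
  position := by rw [hreg 5 (by simp) (by simp), hs.position, hbags]
  token i hi := by rw [hreg _ (by omega) (by omega), hs.token i hi, hbranch]
  start i hi := by rw [harr 0 (by simp), hs.start i hi]
  adj j w hj := by rw [harr 1 (by simp), hs.adj j w hj]
  bag_start i hi := by
    rw [hbags] at hi ⊢
    rw [harr 2 (by simp), hs.bag_start i hi]
  bag j v hj := by
    rw [hbags] at hj
    rw [harr 3 (by simp), hs.bag j v hj]
  pointer v hv := hptr v (by rwa [hpar] at hv)
  par v := by rw [harr 5 (by simp), hs.par v, hpar]

/-- The words that are large enough for the main loop. -/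
structure Fits (n N : ℕ) (L : List (List ℕ)) (W : ℕ) : Prop where
  two_le : 2 ≤ W
  order_le : n ≤ W
  input_le : L.flatten.length ≤ W
  output_le : n * N ≤ W

/-- There is one bag per visited vertex, so an unvisited vertex leaves room for another bag of `N`
entries. -/
theorem State.Inv.fits_bags (ha : a.Inv H A N) (hW : Fits n N L W) {v : Fin n}
    (hv : a.par v = none) : a.bags.flatten.length + N ≤ W ∧ a.bags.length + 1 ≤ W := by
  have h1 := length_flatten_le ha.bag_length
  have h2 : 0 < a.unvisited.card := Finset.card_pos.2 ⟨v, State.mem_unvisited.2 hv⟩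
  have h3 := ha.length_bags
  have h4 : (a.bags.length + 1) * N ≤ n * N := Nat.mul_le_mul_right _ (by omega)
  have h5 := hW.output_le
  have h6 := hW.order_le
  rw [Nat.add_mul] at h4
  omega

/-- The memory after a step of the main loop from the state `a`. -/
def StepPost (H : SimpleGraph (Fin n)) (A : Fin n → List (Fin n)) (L : List (List ℕ)) (N : ℕ)
    (a : State n) (s' : Store) : Prop :=
  ∃ a' : State n, a'.Inv H A N ∧ Represents L N a' s' ∧
    ((s'.reg 6 = 0 ∧ a'.potential A N + 1 ≤ a.potential A N) ∨
      (s'.reg 6 = 1 ∧ ∀ i < N, a'.branch i ≠ []) ∨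
      (s'.reg 6 = 2 ∧ ∀ v, a'.par v ≠ none))

theorem wp_rootProgram (hA : ∀ v w, w ∈ A v ↔ H.Adj v w) (hN : 0 < N) (hW : Fits n N L W)
    (ha : a.Inv H A N) (hs : Represents L N a s) (h6 : s.reg 6 = 0) (h0 : a.branch 0 = []) :
    (rootProgram N).wp W s (StepPost H A L N a) := by
  have hW2 := hW.two_le
  have hWn := hW.order_le
  refine ⟨fun hb => ?_, fun hb => ?_⟩
  · simp only [Test.holds, hs.next, hs.order] at hb
    refine ⟨hW2, a, ha, hs.congr rfl rfl rfl ?_ ?_ ?_ ?_, .inr (.inr ⟨by simp, ?_⟩)⟩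
    · intro r hr hr'
      rw [run_const_reg, if_neg (by omega)]
    · simp [hs.next]
    · intro B hB; rfl
    · exact hs.pointer
    · exact fun v => ha.next_visited v (by omega)
  · simp only [Test.holds, hs.next, hs.order] at hb
    have hlt : a.next < n := lt_of_le_of_ne ha.next_le hb
    let v : Fin n := ⟨a.next, hlt⟩
    have hcode := code_le (a.par v)
    have hpar := hs.par v
    simp only [v] at hpar
    simp only [Program.wp, Op.value, run_add_reg, run_add_arr, hs.next, hs.one, hs.zero,
      Nat.reduceEqDiff, if_true, if_false, add_zero, hpar]
    refine ⟨by omega, by omega, by omega, by simp only [v] at hcode; omega, ?_⟩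
    generalize hs₁ : Op.run _ (.load 11 5 8) = s₁
    have h11 : s₁.reg 11 = code (a.par v) := by
      rw [← hs₁]
      simp [hs.next, hs.one, hs.zero, hpar, v]
    have h2 : s₁.reg 2 = 0 := by
      rw [← hs₁]
      simp [hs.zero]
    have h6' : s₁.reg 6 = 0 := by
      rw [← hs₁]
      simp [h6]
    have hrep : Represents L N ({ a with next := a.next + 1 } : State n) s₁ := by
      refine hs.congr rfl rfl rfl ?_ ?_ ?_ ?_
      · intro r hr hr'
        rw [← hs₁]
        simp only [run_load_reg, run_add_reg, if_neg hr]
        rw [if_neg (by omega), if_neg (by omega), if_neg (by omega)]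
      · rw [← hs₁]
        simp [hs.next, hs.one]
      · intro B hB
        rw [← hs₁]
        simp
      · intro u hu
        rw [← hs₁]
        exact hs.pointer u hu
    refine ⟨fun hb => ?_, fun hb => ?_⟩
    · simp only [Test.holds, h11, h2, code_eq_zero] at hb
      obtain ⟨hpos, hlen⟩ := ha.fits_bags hW hb
      -- The root of a search tree is recorded as its own parent.
      refine Program.wp_mono (wp_placeProgram hrep (x := v) (y := v) ?_ ?_
        (ha.scan_unvisited v hb) hWn hW.input_le hpos hlen) ?_
      · rw [← hs₁]
        simp [hs.next, hs.one, v]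
      · rw [← hs₁]
        simp [hs.next, hs.one, hs.zero, v]
      · rintro s' ⟨hs', h6''⟩
        -- The machine increments the candidate before placing it, but the invariant allows this
        -- only once the vertex is visited. The two updates commute definitionally.
        have hplace := ha.place hA (c := 0) (x := v) (y := v) h0 hN hb
          (fun p hp => absurd rfl hp.ne_zero)
        have hpot := State.potential_place (A := A) (N := N) (c := 0) (x := v) hb
        obtain ⟨hinv, hpot'⟩ := hplace.next_succ (v := v) rfl (by simp [State.place])
        refine ⟨_, hinv, hs', .inl ⟨by rw [h6'', h6'], ?_⟩⟩
        omega
    · simp only [Test.holds, h11, h2, code_eq_zero] at hb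
      obtain ⟨hinv, hpot⟩ := ha.next_succ (v := v) rfl hb
      exact ⟨_, hinv, hrep, .inl ⟨h6', hpot⟩⟩

theorem Represents.contract (hs : Represents L N a s) (ha : a.Inv H A N) {p t : ℕ} {s' : Store}
    (htok : ∀ i < N, s'.reg (i + 20) = if reroot p t i < N then s.reg (reroot p t i + 20) else 0)
    (hreg : ∀ r, r < 20 ∨ N + 20 ≤ r → s'.reg r = s.reg r) (harr : s'.arr = s.arr) :
    Represents L N (a.contract p t) s' where
  order := by rw [hreg 0 (by simp), hs.order]
  length := by rw [hreg 1 (by simp), hs.length]; rfl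
  zero := by rw [hreg 2 (by simp), hs.zero]
  one := by rw [hreg 3 (by simp), hs.one]
  next := by rw [hreg 4 (by simp), hs.next]; rfl
  position := by rw [hreg 5 (by simp), hs.position]; rfl
  token i hi := by
    rw [htok i hi, State.head?_branch_contract]
    split
    · next h => exact hs.token _ h
    · next h =>
      have : a.branch (reroot p t i) = [] := by
        by_contra hne
        exact h (ha.range _ hne)
      simp [this, code]
  start i hi := by rw [harr, hs.start i hi]
  adj j w hj := by rw [harr, hs.adj j w hj]
  bag_start i hi := by rw [harr]; exact hs.bag_start i hi
  bag j v hj := by rw [harr]; exact hs.bag j v hj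
  pointer v hv := by rw [harr]; exact hs.pointer v hv
  par v := by rw [harr]; exact hs.par v

/-- The next neighbour of `x` is unvisited (`place` and `advance`), or visited (`advance`), or there
is none (`contract`). -/
theorem wp_childProgram (hA : ∀ v w, w ∈ A v ↔ H.Adj v w)
    (hL : ∀ v : Fin n, L[(v : ℕ)]? = some ((A v).map Fin.val)) (hW : Fits n N L W)
    (ha : a.Inv H A N) (hs : Represents L N a s) (h6 : s.reg 6 = 0) {c p t : ℕ} (hcN : c < N)
    (hc : a.branch c = []) (hp : a.branch p ≠ []) (hcp : IsChild c p) (htp : IsChild t p)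
    (htc : t ≠ c) :
    (childProgram N c p t).wp W s (StepPost H A L N a) := by
  have hWn := hW.order_le
  have hWL := hW.input_le
  have hpN := ha.range p hp
  obtain ⟨x, hx⟩ := Option.isSome_iff_exists.1 (List.isSome_head?.2 hp)
  have hxn := x.2
  have hxv : a.par x ≠ none := ha.visited p x (mem_of_head?_eq hx)
  have htok := hs.token p hpN
  simp only [hx, code] at htok
  have hptr := hs.pointer x hxv
  -- Since `x` is coded as `x + 1`, its code indexes the start of the next list, which is the end of
  -- its own.
  have hend := hs.start (x + 1) hxn
  rw [length_flatten_take_succ (hL x), List.length_map] at hend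
  have hscan := ha.scan_le x
  have hendW : (L.take x).flatten.length + (A x).length ≤ W := by
    have := length_flatten_take_le (L := L) (x + 1)
    rw [length_flatten_take_succ (hL x), List.length_map] at this
    omega
  simp only [childProgram, Program.wp, Op.value, run_add_reg, run_load_reg, run_add_arr,
    run_load_arr, Nat.reduceEqDiff, if_true, if_false, htok, hs.zero, add_zero, hptr, hend]
  refine ⟨by omega, by omega, by omega, fun hb => ?_, fun hb => ?_⟩
  · simp only [Test.holds, run_load_reg, run_add_reg, run_load_arr, run_add_arr, Nat.reduceEqDiff,
      if_true, if_false, htok, hs.zero, add_zero, hptr, hend] at hb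
    have hlt : a.scan x < (A x).length := by omega
    obtain ⟨w, hw⟩ : ∃ w, (A x)[a.scan x]? = some w := ⟨_, List.getElem?_eq_getElem hlt⟩
    have hxw : H.Adj x w := (hA x w).1 (List.mem_of_getElem? hw)
    have hadj : s.arr 1 ((L.take x).flatten.length + a.scan x) = w := by
      refine hs.adj _ _ ?_
      rw [getElem?_flatten_take (hL x) (by simpa using hlt), List.getElem?_map, hw]
      rfl
    have hwn := w.2
    have hparw := hs.par w
    have hcode := code_le (a.par w)
    simp only [hadj, hs.one, run_store_reg, run_store_arr, run_add_reg, run_load_reg, run_load_arr,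
      run_add_arr, Nat.reduceEqDiff, if_true, if_false, false_and, hptr, htok, hs.zero, hparw,
      add_zero]
    refine ⟨by omega, by omega, by omega, by omega, by omega, ?_⟩
    generalize hs₁ : Op.run _ (.load 11 5 8) = s₁
    have h11 : s₁.reg 11 = code (a.par w) := by
      rw [← hs₁]
      simp [hs.one, hs.zero, hptr, htok, hadj, hparw, -List.length_flatten]
    have h2 : s₁.reg 2 = 0 := by
      rw [← hs₁]
      simp [hs.zero]
    have h6' : s₁.reg 6 = 0 := by
      rw [← hs₁]
      simp [h6]
    have hrep : Represents L N (a.advance x) s₁ := by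
      refine hs.congr rfl rfl rfl ?_ ?_ ?_ ?_
      · intro r hr hr'
        rw [← hs₁]
        simp only [run_load_reg, run_add_reg, run_store_reg]
        repeat rw [if_neg (by omega)]
      · rw [← hs₁]
        simp [hs.next, State.advance]
      · intro B hB
        rw [← hs₁]
        funext j
        simp [hB]
      · intro u hu
        rw [← hs₁]
        simp only [run_load_arr, run_store_arr, run_add_reg, run_load_reg, run_add_arr, htok, hptr,
          hs.zero, hs.one, Nat.reduceEqDiff, if_true, if_false, true_and, add_zero,
          Nat.add_right_cancel_iff, Fin.val_inj, State.advance, Function.update_apply]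
        split
        · next h => rw [h]; omega
        · exact hs.pointer u hu
    refine ⟨fun hw0 => ?_, fun hw0 => ?_⟩
    · simp only [Test.holds, h11, h2, code_eq_zero] at hw0
      obtain ⟨hpos, hlen⟩ := ha.fits_bags hW hw0
      have hwx : w ≠ x := by rintro rfl; exact hxv hw0
      refine Program.wp_mono (wp_placeProgram hrep (c := c) (x := x) (y := w) ?_ ?_ ?_
        hWn hW.input_le hpos hlen) ?_
      · rw [← hs₁]
        simp [htok, hs.zero]
      · rw [← hs₁]
        simp [htok, hs.zero, hptr, hadj, hs.one, -List.length_flatten]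
      · simpa [State.advance, hwx] using ha.scan_unvisited w hw0
      · rintro s' ⟨hs', h6''⟩
        -- The memory was obtained by advancing first and placing second. The invariant needs the
        -- opposite order, as `advance` requires `w` to be visited; the resulting states are
        -- definitionally equal.
        have hplace := ha.place hA (c := c) (x := x) (y := w) hc hcN hw0 fun q hq => by
          rw [hq.parent_eq hcp]
          exact ⟨hx, hxw.symm⟩
        have hpot := State.potential_place (A := A) (N := N) (c := c) (x := x) hw0
        have hinv := hplace.advance (v := x) (w := w) (by simp [State.place, hwx.symm, hxv]) hw
          (by simp [State.place])
        have hpot' := State.potential_advance (A := A) (N := N) (a := a.place N c x w) (v := x) hlt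
        exact ⟨_, hinv, hs', .inl ⟨by rw [h6'', h6'], by omega⟩⟩
    · simp only [Test.holds, h11, h2, code_eq_zero] at hw0
      exact ⟨_, ha.advance hxv hw hw0, hrep, .inl ⟨h6', State.potential_advance hlt⟩⟩
  · simp only [Test.holds, run_load_reg, run_add_reg, run_load_arr, run_add_arr, Nat.reduceEqDiff,
      if_true, if_false, htok, hs.zero, add_zero, hptr, hend] at hb
    generalize hs₁ : Op.run _ (.load 10 0 7) = s₁
    have hreg : ∀ r, r < 7 ∨ 20 ≤ r → s₁.reg r = s.reg r := by
      intro r hr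
      rw [← hs₁]
      simp only [run_load_reg, run_add_reg]
      repeat rw [if_neg (by omega)]
    have harr : s₁.arr = s.arr := by
      rw [← hs₁]
      simp
    have hrep : Represents L N a s₁ := hs.congr rfl rfl rfl (fun r _ h => hreg r (by omega))
      (by rw [hreg 4 (by simp), hs.next]) (fun B _ => by rw [harr])
      fun v hv => by rw [harr]; exact hs.pointer v hv
    refine Program.wp_mono (wp_contractProgram htp.lt.le le_rfl hrep.zero ?_) ?_
    · intro i hi
      rw [hrep.token i hi]
      exact (code_le _).trans hWn
    · rintro s' ⟨htok', hreg', harr'⟩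
      exact ⟨_, ha.contract htp hcp htc hc hx (by omega), hrep.contract ha htok' hreg' harr',
        .inl ⟨by rw [hreg' 6 (by simp), hreg 6 (by simp), h6], ha.potential_contract htp hx⟩⟩

/-- All positions before the one under test are occupied. Parents precede children in heap order, so
the first empty position is the root or has an occupied parent. -/
theorem wp_searchProgram (hA : ∀ v w, w ∈ A v ↔ H.Adj v w)
    (hL : ∀ v : Fin n, L[(v : ℕ)]? = some ((A v).map Fin.val)) (hW : Fits n N L W)
    (ha : a.Inv H A N) (hs : Represents L N a s) (h6 : s.reg 6 = 0) {k : ℕ} (hk : k ≤ N)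
    (hocc : ∀ i < N - k, a.branch i ≠ []) :
    (searchProgram N k).wp W s (StepPost H A L N a) := by
  induction k with
  | zero =>
    have hW2 := hW.two_le
    refine ⟨by simp only [Op.value]; omega, a, ha, hs.congr rfl rfl rfl ?_ ?_ ?_ ?_,
      .inr (.inl ⟨by simp, hocc⟩)⟩
    · intro r hr hr'
      rw [run_const_reg, if_neg (by omega)]
    · simp [hs.next]
    · intro B hB; rfl
    · exact hs.pointer
  | succ k ih =>
    have htok := hs.token (N - (k + 1)) (by omega)
    refine ⟨fun hb => ?_, fun hb => ?_⟩
    · simp only [Test.holds, hs.zero, htok, code_eq_zero, List.head?_eq_none_iff] at hb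
      split
      · next h =>
        rw [h] at hb
        exact wp_rootProgram hA (by omega) hW ha hs h6 hb
      · next h =>
        obtain ⟨p, hp⟩ := exists_isChild h
        have hlt := hp.lt
        have hpe : (N - (k + 1) - 1) / 2 = p := by rcases hp with hp | hp <;> omega
        rw [hpe]
        refine wp_childProgram hA hL hW ha hs h6 (by omega) hb (hocc p hlt) hp ?_ ?_ <;>
          simp only [IsChild] at hp ⊢ <;> omega
    · simp only [Test.holds, hs.zero, htok, code_eq_zero, List.head?_eq_none_iff] at hb
      refine ih (by omega) fun i hi => ?_
      rcases Nat.lt_or_ge i (N - (k + 1)) with h | h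
      · exact hocc i h
      · have : i = N - (k + 1) := by omega
        rwa [this]

/-- The main loop. -/
theorem runs_searchProgram (hA : ∀ v w, w ∈ A v ↔ H.Adj v w)
    (hL : ∀ v : Fin n, L[(v : ℕ)]? = some ((A v).map Fin.val)) (hW : Fits n N L W)
    (ha : a.Inv H A N) (hs : Represents L N a s) (h6 : s.reg 6 = 0) :
    Runs W (.while (.eq 6 2) (searchProgram N N)) s
      ((a.potential A N + 1) * ((searchProgram N N).cost + 1) + 1) fun s' =>
        ∃ a' : State n, a'.Inv H A N ∧ Represents L N a' s' ∧
          ((s'.reg 6 = 1 ∧ ∀ i < N, a'.branch i ≠ []) ∨ (s'.reg 6 = 2 ∧ ∀ v, a'.par v ≠ none)) := by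
  -- Status `0` means running, `1` that the tree is full, `2` that all vertices are visited. Tests
  -- compare registers, and register `2` holds `0`.
  refine (Runs.loop (fun m s => ∃ a : State n, a.Inv H A N ∧ Represents L N a s ∧
    ((s.reg 6 = 0 ∧ a.potential A N + 1 ≤ m) ∨
      (s.reg 6 = 1 ∧ ∀ i < N, a.branch i ≠ []) ∨
      (s.reg 6 = 2 ∧ ∀ v, a.par v ≠ none))) ?_ ⟨a, ha, hs, .inl ⟨h6, le_rfl⟩⟩).mono le_rfl ?_
  · rintro m s ⟨a, ha, hs, h⟩ hb
    simp only [Test.holds, hs.zero] at hb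
    rcases h with ⟨-, hm⟩ | ⟨h, -⟩ | ⟨h, -⟩
    · refine (wp_searchProgram hA hL hW ha hs hb le_rfl (by simp)).runs.mono le_rfl ?_
      rintro s' ⟨a', ha', hs', h'⟩
      -- A final step need not lower the potential; `m` is positive because it exceeds the
      -- potential.
      refine ⟨m - 1, by omega, a', ha', hs', h'.imp_left fun h => ⟨h.1, by omega⟩⟩
    · omega
    · omega
  · rintro s' ⟨m, -, ⟨a', ha', hs', h⟩, hb⟩
    simp only [Test.holds, hs'.zero] at hb
    exact ⟨a', ha', hs', h.resolve_left fun h => hb h.1⟩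

end

/-! ### Writing the embedding -/

/-- Replace the vertex in register `7` by its parent and set register `9` if this is the vertex at
the position `p`. -/
def climbProgram (p : ℕ) (q : Program) : Program :=
  .seq (.op (.load 7 5 7)) <| .seq q <| .ite (.eq 7 (p + 20)) (.op (.const 9 1)) .skip

/-- Add the number of edges of a path to register `5`. -/
def measureProgram (p : ℕ) : Program :=
  .while (.eq 9 2) (climbProgram p (.op (.add 5 5 3)))

/-- Write a path backwards from the position in register `10`. -/
def copyProgram (p : ℕ) : Program :=
  .while (.eq 9 2) (climbProgram p
    (.seq (.op (.sub 10 10 3)) <| .seq (.op (.sub 11 7 3)) (.op (.store 3 10 11))))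

/-- Prepare a climb from the position `i`. -/
def prepareProgram (i : ℕ) : Program :=
  .seq (.op (.add 7 (i + 20) 2)) (.op (.const 9 0))

/-- Write the path from the position `p` to the position `i`. -/
def writePathProgram (i p : ℕ) : Program :=
  .seq (prepareProgram i) <| .seq (measureProgram p) <| .seq
    (.seq (.op (.add 10 5 2)) <| .seq (.op (.add 5 5 3)) <| .seq (.op (.const 8 (i + 1))) <|
      .seq (.op (.store 2 8 5)) <| .seq (prepareProgram i) <|
      .seq (.op (.sub 11 7 3)) (.op (.store 3 10 11)))
    (copyProgram p)

/-- Write the vertex at the root. -/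
def writeRootProgram : Program :=
  .seq (.op (.const 5 0)) <| .seq (.op (.sub 11 20 3)) <| .seq (.op (.store 3 5 11)) <|
    .seq (.op (.add 5 5 3)) (.op (.store 2 3 5))

/-- Write the root and the paths to the next `k` positions. -/
def writePathsProgram : ℕ → Program
  | 0 => writeRootProgram
  | k + 1 => .seq (writePathsProgram k) (writePathProgram (k + 1) (k / 2))

section

variable {n N W d p : ℕ} {s : Store} {g : ℕ → Fin n}

/-- The climb stops when it meets the vertex `g d`, and `hne` says that this does not happen before
the step `d`. -/
theorem runs_measureProgram (hpar : ∀ j < d, s.arr 5 (g j + 1) = g (j + 1) + 1)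
    (hne : ∀ j < d, g j ≠ g d) (hd : 0 < d) (h7 : s.reg 7 = g 0 + 1) (hp : s.reg (p + 20) = g d + 1)
    (h9 : s.reg 9 = 0) (h2 : s.reg 2 = 0) (h3 : s.reg 3 = 1) (hW1 : 1 ≤ W) (hW : n ≤ W)
    (h5 : s.reg 5 + d ≤ W) :
    Runs W (measureProgram p) s (d * 5 + 1) fun s' => s'.reg 5 = s.reg 5 + d ∧
      (∀ r, r ≠ 5 → r ≠ 7 → r ≠ 9 → s'.reg r = s.reg r) ∧ s'.arr = s.arr := by
  -- A round costs at most four steps, apart from the loop test: the climb, the count, the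
  -- comparison and the flag.
  refine (Runs.loop (K := 4) (fun m s' => ∃ j ≤ d, m = d - j ∧ s'.reg 7 = g j + 1 ∧
    s'.reg 5 = s.reg 5 + j ∧ s'.reg 9 = (if j = d then 1 else 0) ∧
    (∀ r, r ≠ 5 → r ≠ 7 → r ≠ 9 → s'.reg r = s.reg r) ∧ s'.arr = s.arr) ?_ (m := d)
    ⟨0, by omega, rfl, h7, rfl, by rw [if_neg hd.ne, h9], fun _ _ _ _ => rfl, rfl⟩).mono le_rfl ?_
  · rintro m s' ⟨j, hj, rfl, h7', h5', h9', hreg, harr⟩ hb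
    have h2' : s'.reg 2 = 0 := by rw [hreg 2 (by simp) (by simp) (by simp), h2]
    have h3' : s'.reg 3 = 1 := by rw [hreg 3 (by simp) (by simp) (by simp), h3]
    have hp' : s'.reg (p + 20) = g d + 1 := by
      rw [hreg _ (by omega) (by omega) (by omega), hp]
    have hjd : j ≠ d := by
      rintro rfl
      simp [Test.holds, h9', h2'] at hb
    have hpar' := hpar j (by omega)
    have hgn := (g (j + 1)).2
    have hwp : (climbProgram p (.op (.add 5 5 3))).wp W s' fun s'' => ∃ m' < d - j, ∃ j ≤ d,
        m' = d - j ∧ s''.reg 7 = g j + 1 ∧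
        s''.reg 5 = s.reg 5 + j ∧ s''.reg 9 = (if j = d then 1 else 0) ∧
        (∀ r, r ≠ 5 → r ≠ 7 → r ≠ 9 → s''.reg r = s.reg r) ∧ s''.arr = s.arr := by
      simp only [climbProgram, Program.wp, Op.value, Test.holds, run_load_reg, run_add_reg,
        h7', harr, hpar', h5', h3', Nat.reduceEqDiff, if_true, if_false, hp']
      refine ⟨by omega, by omega, fun hb => ⟨hW1, d - (j + 1), by omega, j + 1, by omega, rfl, ?_⟩,
        fun hb => ⟨d - (j + 1), by omega, j + 1, by omega, rfl, ?_⟩⟩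
      · have : j + 1 = d := by
          by_contra h
          exact hne (j + 1) (by omega) (Fin.ext (by omega))
        refine ⟨by simp [h7', harr, hpar'], by simp [h5', h3']; omega, by simp [this], ?_,
          by simpa using harr⟩
        intro r hr5 hr7 hr9
        simpa [hr5, hr7, hr9] using hreg r hr5 hr7 hr9
      · have : j + 1 ≠ d := by
          intro h
          exact hb (by rw [h])
        refine ⟨rfl, by omega, by simp [this, h9', hjd], ?_,
          by simpa using harr⟩
        intro r hr5 hr7 hr9
        simpa [hr5, hr7, hr9] using hreg r hr5 hr7 hr9
    exact hwp.runs.mono (by simp [climbProgram, Program.cost]) fun _ h => h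
  · rintro s' ⟨m, -, ⟨j, hj, -, -, h5', h9', hreg, harr⟩, hb⟩
    have h2' : s'.reg 2 = 0 := by rw [hreg 2 (by simp) (by simp) (by simp), h2]
    have hjd : j = d := by
      by_contra hjd
      simp [Test.holds, h9', h2', hjd] at hb
    exact ⟨by rw [h5', hjd], hreg, harr⟩

/-- Forest parents lead from child to parent, while the output runs from parent to child. Hence the
length is measured by one climb, and a second climb writes backwards from the end. Only array `3`
changes, so the parents stay readable. -/
theorem runs_copyProgram (hpar : ∀ j < d, s.arr 5 (g j + 1) = g (j + 1) + 1)
    (hne : ∀ j < d, g j ≠ g d) (hd : 0 < d) (h7 : s.reg 7 = g 0 + 1) (hp : s.reg (p + 20) = g d + 1)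
    (h9 : s.reg 9 = 0) (h2 : s.reg 2 = 0) (h3 : s.reg 3 = 1) (hW1 : 1 ≤ W) (hW : n ≤ W) {o : ℕ}
    (h10 : s.reg 10 = o + d) (ho : o + d ≤ W) (h0 : s.arr 3 (o + d) = g 0) :
    Runs W (copyProgram p) s (d * 7 + 1) fun s' =>
      (∀ r, r ≠ 7 → r ≠ 9 → r ≠ 10 → r ≠ 11 → s'.reg r = s.reg r) ∧
      (∀ j ≤ d, s'.arr 3 (o + d - j) = g j) ∧ (∀ j < o, s'.arr 3 j = s.arr 3 j) ∧
      ∀ B, B ≠ 3 → s'.arr B = s.arr B := by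
  refine (Runs.loop (K := 6) (fun m s' => ∃ j ≤ d, m = d - j ∧ s'.reg 7 = g j + 1 ∧
    s'.reg 10 = o + d - j ∧ s'.reg 9 = (if j = d then 1 else 0) ∧
    (∀ r, r ≠ 7 → r ≠ 9 → r ≠ 10 → r ≠ 11 → s'.reg r = s.reg r) ∧
    (∀ i ≤ j, s'.arr 3 (o + d - i) = g i) ∧ (∀ j < o, s'.arr 3 j = s.arr 3 j) ∧
      ∀ B, B ≠ 3 → s'.arr B = s.arr B) ?_ (m := d)
    ⟨0, by omega, rfl, h7, h10, by rw [if_neg hd.ne, h9], fun _ _ _ _ _ => rfl,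
      fun i hi => by rw [Nat.le_zero.1 hi]; exact h0, fun _ _ => rfl, fun _ _ => rfl⟩).mono
      le_rfl ?_
  · rintro m s' ⟨j, hj, rfl, h7', h10', h9', hreg, hnew, hold, harr⟩ hb
    have h2' : s'.reg 2 = 0 := by rw [hreg 2 (by simp) (by simp) (by simp) (by simp), h2]
    have h3' : s'.reg 3 = 1 := by rw [hreg 3 (by simp) (by simp) (by simp) (by simp), h3]
    have hp' : s'.reg (p + 20) = g d + 1 := by
      rw [hreg _ (by omega) (by omega) (by omega) (by omega), hp]
    have hjd : j ≠ d := by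
      rintro rfl
      simp [Test.holds, h9', h2'] at hb
    have hpar' := hpar j (by omega)
    rw [← harr 5 (by simp)] at hpar'
    have hgn := (g (j + 1)).2
    have hwp : (climbProgram p (.seq (.op (.sub 10 10 3)) <| .seq (.op (.sub 11 7 3))
        (.op (.store 3 10 11)))).wp W s' fun s'' => ∃ m' < d - j, ∃ j ≤ d,
        m' = d - j ∧ s''.reg 7 = g j + 1 ∧
        s''.reg 10 = o + d - j ∧ s''.reg 9 = (if j = d then 1 else 0) ∧
        (∀ r, r ≠ 7 → r ≠ 9 → r ≠ 10 → r ≠ 11 → s''.reg r = s.reg r) ∧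
        (∀ i ≤ j, s''.arr 3 (o + d - i) = g i) ∧ (∀ j < o, s''.arr 3 j = s.arr 3 j) ∧
        ∀ B, B ≠ 3 → s''.arr B = s.arr B := by
      simp only [climbProgram, Program.wp, Op.value, Test.holds, run_load_reg, run_sub_reg,
        run_store_reg, h7', hpar', h10', h3', Nat.reduceEqDiff, if_true, if_false, hp',
        Nat.add_sub_cancel]
      refine ⟨by omega, by omega, by omega, by omega,
        fun hb => ⟨hW1, d - (j + 1), by omega, j + 1, by omega, rfl, ?_⟩,
        fun hb => ⟨d - (j + 1), by omega, j + 1, by omega, rfl, ?_⟩⟩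
      · have : j + 1 = d := by
          by_contra h
          exact hne (j + 1) (by omega) (Fin.ext (by omega))
        refine ⟨by simp [h7', hpar'], by simp [h10', h3']; omega, by simp [this], ?_, ?_, ?_, ?_⟩
        · intro r hr7 hr9 hr10 hr11
          simpa [hr10, hr7, hr9, hr11] using hreg r hr7 hr9 hr10 hr11
        · intro i hi
          simp only [run_const_arr, run_store_arr, run_sub_reg, run_load_reg, run_sub_arr,
            run_load_arr, h7', hpar', h10', h3', Nat.reduceEqDiff, if_true, if_false, true_and,
            Nat.add_sub_cancel]
          split
          · next h => rw [show i = j + 1 by omega]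
          · next h => exact hnew i (by omega)
        · intro i hi
          simp only [run_const_arr, run_store_arr, run_sub_reg, run_load_reg, run_sub_arr,
            run_load_arr, h10', h3', Nat.reduceEqDiff, if_true, if_false, true_and]
          rw [if_neg (by omega)]
          exact hold i hi
        · intro B hB
          funext i
          simp [hB, harr B hB]
      · have : j + 1 ≠ d := by
          intro h
          exact hb (by rw [h])
        refine ⟨rfl, by omega, by simp [this, h9', hjd], ?_, ?_,
          ?_, ?_⟩
        · intro r hr7 hr9 hr10 hr11
          simpa [hr10, hr7, hr9, hr11] using hreg r hr7 hr9 hr10 hr11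
        · intro i hi
          simp only [run_store_arr, run_sub_reg, run_load_reg, run_sub_arr,
            run_load_arr, h7', hpar', h10', h3', Nat.reduceEqDiff, if_true, if_false, true_and,
            Nat.add_sub_cancel]
          split
          · next h => rw [show i = j + 1 by omega]
          · next h => exact hnew i (by omega)
        · intro i hi
          simp only [run_store_arr, run_sub_reg, run_load_reg, run_sub_arr,
            run_load_arr, h10', h3', Nat.reduceEqDiff, if_true, if_false, true_and]
          rw [if_neg (by omega)]
          exact hold i hi
        · intro B hB
          funext i
          simp [hB, harr B hB]
    exact hwp.runs.mono (by simp [climbProgram, Program.cost]) fun _ h => h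
  · rintro s' ⟨m, -, ⟨j, hj, -, -, -, h9', hreg, hnew, hold, harr⟩, hb⟩
    have h2' : s'.reg 2 = 0 := by rw [hreg 2 (by simp) (by simp) (by simp) (by simp), h2]
    have hjd : j = d := by
      by_contra hjd
      simp [Test.holds, h9', h2', hjd] at hb
    subst hjd
    exact ⟨hreg, hnew, hold, harr⟩

/-- The vertices along a climb are written from `o` to `o + d`, the last one first. -/
theorem runs_writePathProgram {i : ℕ} (hpar : ∀ j < d, s.arr 5 (g j + 1) = g (j + 1) + 1)
    (hne : ∀ j < d, g j ≠ g d) (hd : 0 < d) (hi : s.reg (i + 20) = g 0 + 1)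
    (hp : s.reg (p + 20) = g d + 1) (h2 : s.reg 2 = 0) (h3 : s.reg 3 = 1)
    (hW : n ≤ W) (hi' : i + 1 ≤ W) (h5 : s.reg 5 + d + 1 ≤ W) :
    Runs W (writePathProgram i p) s (d * 12 + 12) fun s' =>
      s'.reg 5 = s.reg 5 + d + 1 ∧ (∀ r, r < 5 ∨ 20 ≤ r → s'.reg r = s.reg r) ∧
      (∀ j ≤ d, s'.arr 3 (s.reg 5 + d - j) = g j) ∧
      (∀ j < s.reg 5, s'.arr 3 j = s.arr 3 j) ∧
      (∀ j, s'.arr 2 j = if j = i + 1 then s.reg 5 + d + 1 else s.arr 2 j) ∧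
      s'.arr 5 = s.arr 5 := by
  have hW1 : 1 ≤ W := by omega
  have hg0 := (g 0).2
  have hprep : (prepareProgram i).wp W s fun s' => s'.reg 7 = g 0 + 1 ∧ s'.reg 9 = 0 ∧
      (∀ r, r ≠ 7 → r ≠ 9 → s'.reg r = s.reg r) ∧ s'.arr = s.arr := by
    simp only [prepareProgram, Program.wp, Op.value, hi, h2]
    refine ⟨by omega, by omega, by simp [hi, h2], by simp, ?_, by simp⟩
    intro r h7 h9
    simp [h7, h9]
  refine ((hprep.runs.seq (K' := d * 5 + 1 + (8 + (d * 7 + 1))) ?_).mono (by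
    simp only [prepareProgram, Program.cost]; omega) fun _ h => h)
  rintro s₁ ⟨h7₁, h9₁, hreg₁, harr₁⟩
  have hr₁ : ∀ r, r < 7 ∨ 20 ≤ r → s₁.reg r = s.reg r := fun r h =>
    hreg₁ r (by omega) (by omega)
  have hm := runs_measureProgram (W := W) (s := s₁) (p := p) (g := g) (d := d)
    (by rw [harr₁]; exact hpar) hne hd h7₁ (by rw [hr₁ _ (by omega), hp]) h9₁
    (by rw [hr₁ 2 (by simp), h2]) (by rw [hr₁ 3 (by simp), h3]) hW1 hW
    (by rw [hr₁ 5 (by simp)]; omega)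
  refine hm.seq (K' := 8 + (d * 7 + 1)) ?_
  rintro s₂ ⟨h5₂, hreg₂, harr₂⟩
  have hr₂ : ∀ r, r < 5 ∨ 20 ≤ r → s₂.reg r = s.reg r := fun r h => by
    rw [hreg₂ r (by omega) (by omega) (by omega), hr₁ r (by omega)]
  rw [hr₁ 5 (by simp)] at h5₂
  rw [harr₁] at harr₂
  have hmid : Program.wp W (.seq (.op (.add 10 5 2)) <| .seq (.op (.add 5 5 3)) <|
      .seq (.op (.const 8 (i + 1))) <| .seq (.op (.store 2 8 5)) <| .seq (prepareProgram i) <|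
      .seq (.op (.sub 11 7 3)) (.op (.store 3 10 11))) s₂ fun s' =>
      s'.reg 7 = g 0 + 1 ∧ s'.reg 9 = 0 ∧ s'.reg 10 = s.reg 5 + d ∧ s'.reg 5 = s.reg 5 + d + 1 ∧
      (∀ r, r < 5 ∨ 20 ≤ r → s'.reg r = s.reg r) ∧
      (∀ j, s'.arr 3 j = if j = s.reg 5 + d then (g 0 : ℕ) else s.arr 3 j) ∧
      (∀ j, s'.arr 2 j = if j = i + 1 then s.reg 5 + d + 1 else s.arr 2 j) ∧
      s'.arr 5 = s.arr 5 := by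
    simp only [prepareProgram, Program.wp, Op.value, run_add_reg, run_const_reg, run_store_reg,
      run_sub_reg, hr₂ 2 (by simp), hr₂ 3 (by simp), hr₂ (i + 20) (by omega), hi, h2, h3, h5₂,
      Nat.reduceEqDiff, if_true, if_false, add_zero, Nat.add_sub_cancel]
    refine ⟨by omega, by omega, by omega, by omega, by omega, by omega, by omega, by omega, trivial,
      trivial, trivial, trivial, ?_, ?_, ?_, ?_⟩
    · intro r hr
      repeat rw [if_neg (by omega)]
      exact hr₂ r hr
    · intro j
      simp [hr₂, hi, h2, h3, h5₂, harr₂]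
    · intro j
      simp [hr₂, h2, h3, h5₂, harr₂]
    · funext j
      simp [harr₂]
  refine (hmid.runs.mono (K' := 8) (by simp [prepareProgram, Program.cost]) fun _ h => h).seq ?_
  rintro s₃ ⟨h7₃, h9₃, h10₃, h5₃, hr₃, harr3₃, harr2₃, harr5₃⟩
  have hc := runs_copyProgram (W := W) (s := s₃) (p := p) (g := g) (d := d) (o := s.reg 5)
    (by rw [harr5₃]; exact hpar) hne hd h7₃ (by rw [hr₃ _ (by omega), hp]) h9₃
    (by rw [hr₃ 2 (by simp), h2]) (by rw [hr₃ 3 (by simp), h3]) hW1 hW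
    h10₃ (by omega) (by rw [harr3₃, if_pos rfl])
  refine hc.mono le_rfl ?_
  rintro s₄ ⟨hr₄, hnew, hold, harr₄⟩
  refine ⟨by rw [hr₄ 5 (by simp) (by simp) (by simp) (by simp), h5₃], ?_, hnew, ?_, ?_, ?_⟩
  · intro r hr
    rw [hr₄ r (by omega) (by omega) (by omega) (by omega), hr₃ r hr]
  · intro j hj
    rw [hold j hj, harr3₃, if_neg (by omega)]
  · intro j
    rw [harr₄ 2 (by simp), harr2₃]
  · rw [harr₄ 5 (by simp), harr5₃]

end

section

variable {n N W : ℕ} {L : List (List ℕ)} {s : Store} {a : State n}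
  {H : SimpleGraph (Fin n)} {A : Fin n → List (Fin n)}

/-- The path from the parent position to the position `i`; the root vertex for `i = 0`. -/
def State.treePath (a : State n) (i : ℕ) : List (Fin n) :=
  if i = 0 then (a.branch 0).head?.toList else
    (a.branch ((i - 1) / 2)).head?.toList ++ (a.branch i).reverse

/-- The tree paths to the first `k` positions. -/
def State.treePaths (a : State n) (k : ℕ) : List (List (Fin n)) := (List.range k).map a.treePath

/-- The memory after writing the tree paths to the first `k` positions. -/
structure PathsWritten (a : State n) (N k : ℕ) (s : Store) : Prop where
  zero : s.reg 2 = 0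
  one : s.reg 3 = 1
  token : ∀ i < N, s.reg (i + 20) = code (a.branch i).head?
  par : ∀ v : Fin n, s.arr 5 (v + 1) = code (a.par v)
  position : s.reg 5 = (a.treePaths k).flatten.length
  start : ∀ i ≤ k, s.arr 2 i = ((a.treePaths k).take i).flatten.length
  entry : ∀ (j : ℕ) (v : Fin n), (a.treePaths k).flatten[j]? = some v → s.arr 3 j = v

theorem State.treePaths_succ (a : State n) (k : ℕ) :
    a.treePaths (k + 1) = a.treePaths k ++ [a.treePath k] := by
  simp [treePaths, List.range_succ]

theorem State.length_treePaths (a : State n) (k : ℕ) : (a.treePaths k).length = k := by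
  simp [treePaths]

theorem State.Inv.length_branch_le (ha : a.Inv H A N) (i : ℕ) : (a.branch i).length ≤ n := by
  simpa using (ha.nodup i).length_le_card

theorem State.Inv.length_treePath_le (ha : a.Inv H A N) (i : ℕ) :
    (a.treePath i).length ≤ n + 1 := by
  have h1 := ha.length_branch_le i
  have h2 : ∀ o : Option (Fin n), o.toList.length ≤ 1 := by
    intro o; cases o <;> simp
  unfold treePath
  split
  · exact (h2 _).trans (by omega)
  · have := h2 (a.branch ((i - 1) / 2)).head?
    simp only [List.length_append, List.length_reverse]
    omega

theorem State.Inv.length_flatten_treePaths_le (ha : a.Inv H A N) (k : ℕ) :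
    (a.treePaths k).flatten.length ≤ k * (n + 1) := by
  have := length_flatten_le (L := a.treePaths k) (N := n + 1) fun l hl => by
    obtain ⟨i, -, rfl⟩ := List.mem_map.1 hl
    exact ha.length_treePath_le i
  rwa [State.length_treePaths] at this

/-- By `chain` and `link`, each vertex of a branch has its successor as forest parent, and the last
one has the parent's token. So the paths can be recovered from tokens and forest parents; the
machine never stores the branches. -/
theorem runs_writePathsProgram (ha : a.Inv H A N) (hs : Represents L N a s)
    (hfull : ∀ i < N, a.branch i ≠ []) (hn : n ≤ W) (hW : N * (n + 1) ≤ W) {k : ℕ} (hk : k < N) :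
    Runs W (writePathsProgram k) s (5 + k * (n * 12 + 12)) (PathsWritten a N (k + 1)) := by
  have hNW : N ≤ W := by
    have := Nat.le_mul_of_pos_right N (show 0 < n + 1 by omega)
    omega
  induction k with
  | zero =>
    obtain ⟨v, hv⟩ := Option.isSome_iff_exists.1 (List.isSome_head?.2 (hfull 0 hk))
    have htok := hs.token 0 hk
    simp only [hv, code, Nat.zero_add] at htok
    have hvn := v.2
    have hO : a.treePaths 1 = [[v]] := by simp [State.treePaths, State.treePath, hv]
    have hwp : writeRootProgram.wp W s (PathsWritten a N (0 + 1)) := by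
      simp only [writeRootProgram, Program.wp, Op.value, run_sub_reg, run_const_reg, run_store_reg,
        run_add_reg, htok, hs.one, Nat.reduceEqDiff, if_true, if_false, Nat.add_sub_cancel]
      refine ⟨by omega, by omega, by omega, by omega, by omega, ?_, ?_, ?_, ?_, ?_, ?_, ?_⟩
      · simp [hs.zero]
      · simp [hs.one]
      · intro i hi
        simpa using hs.token i hi
      · intro u
        simpa using hs.par u
      · simp [hs.one, hO]
      · intro i hi
        simp only [run_store_arr, run_add_reg, run_sub_reg, run_const_reg, hs.one,
          Nat.reduceEqDiff, if_true, if_false, true_and, run_add_arr, run_sub_arr, run_const_arr,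
          false_and, hO, run_store_reg]
        interval_cases i
        -- Entry `0` of array `2` is not rewritten: it is already zero as the start of the bags.
        · have := hs.bag_start 0 (by simp)
          simpa using this
        · simp
      · intro j u hj
        rw [hO] at hj
        simp only [List.flatten_cons, List.flatten_nil, List.append_nil] at hj
        have hj0 : j = 0 := by
          have := (List.getElem?_eq_some_iff.1 hj).1
          simpa using this
        subst hj0
        simp only [List.getElem?_cons_zero, Option.some.injEq] at hj
        subst hj
        simp [hs.one, htok]
    exact hwp.runs.mono (by simp [writeRootProgram, Program.cost]) fun _ h => h
  | succ k ih =>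
    refine ((ih (by omega)).seq (K' := n * 12 + 12) ?_).mono (by
      rw [Nat.add_mul k 1, one_mul]; omega) fun _ h => h
    intro s₁ hs₁
    have hchild : IsChild (k + 1) (k / 2) := by
      simp only [IsChild]; omega
    obtain ⟨y, hy⟩ := Option.isSome_iff_exists.1
      (List.isSome_head?.2 (hfull (k / 2) (by omega)))
    obtain ⟨x, l, hx⟩ := List.exists_cons_of_ne_nil (hfull (k + 1) hk)
    -- The vertices met by the climb: the branch, then the token of the parent position, which is
    -- reached after `d` steps.
    let g : ℕ → Fin n := fun j => (a.branch (k + 1) ++ [y]).getD j y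
    let d := (a.branch (k + 1)).length
    have hg : ∀ j (hj : j < d), g j = (a.branch (k + 1))[j]'hj := by
      intro j hj
      simp only [g, List.getD_eq_getElem?_getD]
      rw [List.getElem?_append_left hj, List.getElem?_eq_getElem hj]
      rfl
    have hgd : g d = y := by
      simp [g, d]
    have hd : 0 < d := by simp [d, hx]
    have hdn : d ≤ n := ha.length_branch_le _
    have hpath : a.treePath (k + 1) = (a.branch (k + 1) ++ [y]).reverse := by
      simp [State.treePath, hy]
    have hpar : ∀ j < d, a.par (g j) = some (g (j + 1)) := by
      intro j hj
      rcases Nat.lt_or_ge (j + 1) d with h | h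
      · rw [hg j hj, hg (j + 1) h]
        exact ((List.isChain_iff_getElem.1 (ha.chain (k + 1))) j h).1
      · have hjd : j + 1 = d := by omega
        rw [hjd, hgd, hg j hj]
        refine (ha.link _ _ hchild _ ?_ _ hy).1
        rw [List.getLast?_eq_getElem?]
        simp only [d] at hjd
        rw [← hjd, Nat.add_sub_cancel]
        exact List.getElem?_eq_getElem _
    have hne : ∀ j < d, g j ≠ g d := by
      intro j hj h
      rw [hgd, hg j hj] at h
      exact ha.disjoint _ _ hchild.lt.ne' (List.getElem_mem hj)
        (by rw [h]; exact mem_of_head?_eq hy)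
    have hflat := ha.length_flatten_treePaths_le (k + 1)
    have hmul : (k + 1 + 1) * (n + 1) ≤ N * (n + 1) := Nat.mul_le_mul_right _ hk
    rw [Nat.add_mul (k + 1) 1] at hmul
    have hrun := runs_writePathProgram (W := W) (s := s₁) (i := k + 1) (p := k / 2) (g := g) (d := d)
      (fun j hj => by rw [hs₁.par, hpar j hj]; rfl) hne hd
      (by rw [hs₁.token _ hk, hg 0 hd]; simp [hx, code])
      (by rw [hs₁.token _ (by omega), hy, hgd]; rfl) hs₁.zero hs₁.one hn (by omega)
      (by rw [hs₁.position]; omega)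
    refine hrun.mono (by omega) ?_
    rintro s₂ ⟨h5, hreg, hnew, hold, harr2, harr5⟩
    have hlen : (a.treePath (k + 1)).length = d + 1 := by simp [hpath, d]
    refine ⟨by rw [hreg 2 (by simp), hs₁.zero], by rw [hreg 3 (by simp), hs₁.one], ?_, ?_, ?_, ?_, ?_⟩
    · intro i hi
      rw [hreg _ (by omega), hs₁.token i hi]
    · intro v
      rw [harr5, hs₁.par]
    · rw [h5, hs₁.position, State.treePaths_succ a (k + 1)]
      simp only [List.flatten_append, List.flatten_cons, List.flatten_nil, List.append_nil,
        List.length_append, hlen]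
      omega
    · intro i hi
      rw [harr2, State.treePaths_succ a (k + 1), hs₁.position]
      split
      · next h =>
        rw [List.take_of_length_le (by simp [State.length_treePaths, h])]
        simp only [List.flatten_append, List.flatten_cons, List.flatten_nil, List.append_nil,
          List.length_append, hlen]
        omega
      · next h =>
        rw [List.take_append_of_le_length (by rw [State.length_treePaths]; omega)]
        exact hs₁.start i (by omega)
    · intro j v hj
      rw [State.treePaths_succ a (k + 1)] at hj
      simp only [List.flatten_append, List.flatten_cons, List.flatten_nil, List.append_nil] at hj
      rcases lt_or_ge j (a.treePaths (k + 1)).flatten.length with hlt | hge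
      · rw [List.getElem?_append_left hlt] at hj
        rw [hold j (by rw [hs₁.position]; exact hlt)]
        exact hs₁.entry j v hj
      · rw [List.getElem?_append_right hge] at hj
        have hlt := (List.getElem?_eq_some_iff.1 hj).1
        rw [hlen] at hlt
        -- Entry `q` of the path, counted from the parent, is written at step `d - q` of the climb.
        have hval := hnew (d - (j - (a.treePaths (k + 1)).flatten.length)) (by omega)
        rw [hs₁.position, show (a.treePaths (k + 1)).flatten.length + d -
          (d - (j - (a.treePaths (k + 1)).flatten.length)) = j by omega] at hval
        rw [hval]
        rw [hpath, List.getElem?_reverse (by simp only [List.length_append, List.length_singleton]; omega)] at hj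
        simp only [List.length_append, List.length_singleton, Nat.add_sub_cancel] at hj
        simp only [g, List.getD_eq_getElem?_getD]
        rw [hj]
        rfl

/-! ### Input and output -/

theorem outputs_map_val {O : List (List (Fin n))} (h1 : s.reg 1 = O.length)
    (h2 : ∀ i ≤ O.length, s.arr 2 i = (O.take i).flatten.length)
    (h3 : ∀ (j : ℕ) (v : Fin n), O.flatten[j]? = some v → s.arr 3 j = v) :
    Outputs s (O.map (List.map Fin.val)) := by
  refine ⟨by simpa using h1, ?_, ?_⟩
  · intro i hi
    rw [h2 i (by simpa using hi), ← List.map_take, ← List.map_flatten, List.length_map]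
  · intro j hj
    have hj' : j < O.flatten.length := by
      rwa [← List.map_flatten, List.length_map] at hj
    rw [h3 j _ (List.getElem?_eq_getElem hj')]
    simp [← List.map_flatten]

theorem writesBags_map_val {O : List (List (Fin n))} (h : ∀ B ∈ O, B.Nodup) :
    WritesBags (O.map (List.map Fin.val)) (O.map List.toFinset) := by
  -- In `WritesBags` the list of finsets is coerced to a list of sets by a monadic expression, which
  -- is a plain `map`.
  have hmap : (do let B ← O.map List.toFinset; pure (B : Set (Fin n))) =
      List.map (fun B : Finset (Fin n) => (B : Set (Fin n))) (O.map List.toFinset) :=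
    List.flatMap_pure_eq_map _ _
  rw [WritesBags, hmap, List.map_map, List.forall₂_map_left_iff, List.forall₂_map_right_iff,
    List.forall₂_same]
  intro B hB
  refine ⟨(h B hB).map Fin.val_injective, fun x => ?_⟩
  simp

theorem State.Inv.exists_writesEmbedding {h : ℕ} (ha : a.Inv H A N)
    (hfull : ∀ i < 2 ^ h - 1, a.branch i ≠ []) :
    ∃ E : HomeoEmbedding (binaryTree h) H,
      WritesEmbedding ((a.treePaths (2 ^ h - 1)).map (List.map Fin.val)) E := by
  obtain ⟨E, hhead, hpath⟩ := ha.exists_homeoEmbedding hfull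
  refine ⟨E, by simp [State.length_treePaths], ?_, ?_⟩
  · intro r hr
    have := hhead r
    rw [hr] at this
    have hpos : 0 < 2 ^ h - 1 := by omega
    simp [hr, State.treePaths, hpos, State.treePath, this]
  · intro p i hpi hlt
    have hi := i.2
    have hp : ((i : ℕ) - 1) / 2 = p := by
      rcases binaryTree_adj.1 hpi with h | h <;> omega
    have hi0 : (i : ℕ) ≠ 0 := by omega
    rw [hpath p i hpi hlt]
    simp [State.treePaths, State.treePath, hi0, hp, hhead p]
    rw [← List.map_reverse, List.map_eq_flatMap]

/-! ### Reading the adjacency lists. -/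

theorem IsAdjacencyList.exists_lists (h : IsAdjacencyList H L) :
    ∃ A : Fin n → List (Fin n), L.length = n ∧ (∀ v : Fin n, L[(v : ℕ)]? = some ((A v).map Fin.val)) ∧
      (∀ v, (A v).Nodup) ∧ ∀ v w, w ∈ A v ↔ H.Adj v w := by
  have hlen : L.length = n := by simpa using h.length_eq
  have hget : ∀ v : Fin n, Enumerates (L[(v : ℕ)]'(by omega)) (H.neighborSet v) := by
    intro v
    have := (List.forall₂_iff_get.1 h).2 v (by omega) (by simp)
    simpa using this
  have hlt : ∀ v : Fin n, ∀ x ∈ L[(v : ℕ)]'(by omega), x < n := by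
    intro v x hx
    obtain ⟨w, -, rfl⟩ := ((hget v).2 x).1 hx
    exact w.2
  have hmap : ∀ v : Fin n, ((L[(v : ℕ)]'(by omega)).pmap Fin.mk (hlt v)).map Fin.val =
      L[(v : ℕ)]'(by omega) := by
    intro v
    rw [List.map_pmap]
    simp
  refine ⟨fun v => (L[(v : ℕ)]'(by omega)).pmap Fin.mk (hlt v), hlen, ?_, ?_, ?_⟩
  · intro v
    rw [hmap]
    exact List.getElem?_eq_getElem _
  · intro v
    refine List.Nodup.of_map Fin.val ?_
    rw [hmap]
    exact (hget v).1
  · intro v w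
    rw [← List.mem_map_of_injective Fin.val_injective, hmap, (hget v).2]
    constructor
    · rintro ⟨u, hu, huw⟩
      rwa [Fin.val_injective huw] at hu
    · exact fun hw => ⟨w, hw, rfl⟩

theorem sum_length_adjacency (hnd : ∀ v, (A v).Nodup) (hA : ∀ v w, w ∈ A v ↔ H.Adj v w) :
    ∑ v, (A v).length = 2 * H.edgeSet.ncard := by
  classical
  have h1 : ∀ v, (A v).length = H.degree v := by
    intro v
    rw [← List.toFinset_card_of_nodup (hnd v), ← SimpleGraph.card_neighborFinset_eq_degree]
    congr 1
    ext w
    simp [hA]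
  simp only [h1]
  rw [SimpleGraph.sum_degrees_eq_twice_card_edges, ← SimpleGraph.coe_edgeFinset,
    Set.ncard_coe_finset]

theorem length_flatten_adjacency (hlen : L.length = n)
    (hL : ∀ v : Fin n, L[(v : ℕ)]? = some ((A v).map Fin.val)) :
    L.flatten.length = ∑ v, (A v).length := by
  have : L = List.ofFn fun v : Fin n => (A v).map Fin.val := by
    refine List.ext_getElem? fun i => ?_
    rcases Nat.lt_or_ge i n with h | h
    · rw [hL ⟨i, h⟩, List.getElem?_ofFn, dif_pos h]
    · rw [List.getElem?_eq_none (by omega), List.getElem?_eq_none (by simpa using h)]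
  rw [this, List.length_flatten, List.map_ofFn, List.sum_ofFn]
  simp

/-- Memory that is zero reads as no tokens, no bags and no visited vertices, since `code none` is
`0`; no initialising loop is needed. -/
theorem represents_init (hlen : L.length = n) (h0 : s.reg 0 = n) (h3 : s.reg 3 = 1)
    (hreg : ∀ r, r ≠ 0 → r ≠ 3 → r ≠ 7 → r ≠ 8 → s.reg r = 0)
    (harr : s.arr = (inputStore L).arr) :
    Represents L N (State.init n) s where
  order := h0
  length := by rw [hreg 1 (by simp) (by simp) (by simp) (by simp)]; rfl
  zero := hreg 2 (by simp) (by simp) (by simp) (by simp)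
  one := h3
  next := by rw [hreg 4 (by simp) (by simp) (by simp) (by simp)]; rfl
  position := by rw [hreg 5 (by simp) (by simp) (by simp) (by simp)]; rfl
  token i _ := by
    rw [hreg _ (by omega) (by omega) (by omega) (by omega)]
    rfl
  start i hi := by
    rw [harr]
    simp only [inputStore, if_true]
    rw [if_pos (by omega)]
  adj j w hj := by
    rw [harr]
    simp [inputStore, List.getD_eq_getElem?_getD, hj]
  bag_start i hi := by
    rw [harr]
    simp [inputStore, State.init]
  bag j v hj := by simp [State.init] at hj
  pointer v hv := by simp [State.init] at hv
  par v := by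
    rw [harr]
    simp [inputStore, State.init, code]

/-! ### The whole program -/

/-- Add `k` times register `0` to register `8`. -/
def multiplyProgram : ℕ → Program
  | 0 => .skip
  | k + 1 => .seq (multiplyProgram k) (.op (.add 8 8 0))

theorem cost_multiplyProgram (k : ℕ) : (multiplyProgram k).cost = k := by
  induction k with
  | zero => rfl
  | succ k ih => simp [multiplyProgram, Program.cost, ih]

theorem wp_multiplyProgram {k : ℕ} (hW : s.reg 8 + k * s.reg 0 ≤ W) :
    (multiplyProgram k).wp W s fun s' => s'.reg 8 = s.reg 8 + k * s.reg 0 ∧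
      (∀ r, r ≠ 8 → s'.reg r = s.reg r) ∧ s'.arr = s.arr := by
  induction k with
  | zero => simp [multiplyProgram, Program.wp]
  | succ k ih =>
    rw [Nat.add_mul, one_mul] at hW ⊢
    rw [multiplyProgram, Program.wp]
    refine Program.wp_mono (ih (by omega)) fun s' ⟨h8, hreg, harr⟩ => ?_
    have h0 := hreg 0 (by simp)
    simp only [Program.wp, Op.value, h8, h0]
    refine ⟨by omega, by simp [h8, h0]; omega, ?_, by simpa using harr⟩
    intro r hr
    simpa [hr] using hreg r hr

/-- Run the main loop with `N` positions and write the result. -/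
def decomposeProgram (N : ℕ) : Program :=
  .seq (.while (.eq 6 2) (searchProgram N N)) <| .ite (.eq 6 3)
    (.seq (writePathsProgram (N - 1)) (.seq (.op (.const 1 N)) (.op (.const 0 1))))
    (.op (.const 0 2))

/-- The program for pathwidth `t`, with `N` positions in the guest tree. -/
def mainProgram (t N : ℕ) : Program :=
  .seq (.op (.const 3 1)) <| .seq (.op (.load 7 0 0)) <| .seq (multiplyProgram (2 * t)) <|
    .ite (.lt 8 7) (.op (.const 0 0)) (decomposeProgram N)

theorem runs_decomposeProgram (hA : ∀ v w, w ∈ A v ↔ H.Adj v w)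
    (hL : ∀ v : Fin n, L[(v : ℕ)]? = some ((A v).map Fin.val)) (hW : Fits n N L W)
    (hN : 0 < N) (hW' : N * (n + 1) ≤ W) (ha : a.Inv H A N) (hs : Represents L N a s)
    (h6 : s.reg 6 = 0) :
    Runs W (decomposeProgram N) s
      ((a.potential A N + 1) * ((searchProgram N N).cost + 1) + 1 + (N * (n * 12 + 12) + 8))
      fun s' => ∃ a' : State n, a'.Inv H A N ∧
        ((s'.reg 0 = 1 ∧ (∀ i < N, a'.branch i ≠ []) ∧
            Outputs s' ((a'.treePaths N).map (List.map Fin.val))) ∨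
          (s'.reg 0 = 2 ∧ (∀ v, a'.par v ≠ none) ∧
            Outputs s' (a'.bags.map (List.map Fin.val)))) := by
  have hNW : N ≤ W := by
    have := Nat.le_mul_of_pos_right N (show 0 < n + 1 by omega)
    omega
  have hW2 := hW.two_le
  refine (runs_searchProgram hA hL hW ha hs h6).seq ?_
  rintro s₁ ⟨a', ha', hs₁, hcase⟩
  have hone := hs₁.one
  refine (Runs.ite (K := N * (n * 12 + 12) + 7) (fun hb => ?_) (fun hb => ?_)).mono (by omega)
    fun _ h => h
  · simp only [Test.holds, hone] at hb
    have hfull : ∀ i < N, a'.branch i ≠ [] := by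
      rcases hcase with h | h
      · exact h.2
      · omega
    have hrun := runs_writePathsProgram ha' hs₁ hfull hW.order_le hW' (k := N - 1) (by omega)
    rw [Nat.sub_add_cancel hN] at hrun
    refine (hrun.seq (K' := 2) fun s₂ hs₂ => ?_).mono ?_ fun _ h => h
    · have hwp : Program.wp W (.seq (.op (.const 1 N)) (.op (.const 0 1))) s₂ fun s' =>
          s'.reg 0 = 1 ∧ Outputs s' ((a'.treePaths N).map (List.map Fin.val)) := by
        simp only [Program.wp, Op.value]
        refine ⟨hNW, by omega, by simp, outputs_map_val ?_ ?_ ?_⟩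
        · simp [State.length_treePaths]
        · intro i hi
          rw [State.length_treePaths] at hi
          simpa using hs₂.start i hi
        · intro j v hj
          exact hs₂.entry j v hj
      exact hwp.runs.mono (by simp [Program.cost]) fun s' h => ⟨a', ha', .inl ⟨h.1, hfull, h.2⟩⟩
    · have : (N - 1) * (n * 12 + 12) ≤ N * (n * 12 + 12) := Nat.mul_le_mul_right _ (by omega)
      omega
  · simp only [Test.holds, hone] at hb
    have hvis : ∀ v, a'.par v ≠ none := by
      rcases hcase with h | h
      · exact absurd h.1 hb
      · exact h.2
    have hwp : Program.wp W (.op (.const 0 2)) s₁ fun s' =>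
        s'.reg 0 = 2 ∧ Outputs s' (a'.bags.map (List.map Fin.val)) := by
      simp only [Program.wp, Op.value]
      refine ⟨hW2, by simp, outputs_map_val ?_ ?_ ?_⟩
      · simp [hs₁.length]
      · intro i hi
        exact hs₁.bag_start i hi
      · intro j v hj
        exact hs₁.bag j v hj
    exact hwp.runs.mono (by simp only [Program.cost]; omega)
      fun s' h => ⟨a', ha', .inr ⟨h.1, hvis, h.2⟩⟩

theorem runs_mainProgram {t : ℕ} (h : IsAdjacencyList H L) (hN : 0 < N)
    (hW : (N + 2 * t + 2) * (n + H.edgeSet.ncard + 1) ≤ W) :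
    Runs W (mainProgram t N) (inputStore L)
      ((2 * t + 20 + (2 * t + 3) * ((searchProgram N N).cost + 1) + 12 * N) * (n + 1)) fun s' =>
        (s'.reg 0 = 0 ∧ t * n < H.edgeSet.ncard) ∨
        ∃ (A : Fin n → List (Fin n)) (a : State n), a.Inv H A N ∧
          ((s'.reg 0 = 1 ∧ (∀ i < N, a.branch i ≠ []) ∧
              Outputs s' ((a.treePaths N).map (List.map Fin.val))) ∨
            (s'.reg 0 = 2 ∧ (∀ v, a.par v ≠ none) ∧
              Outputs s' (a.bags.map (List.map Fin.val)))) := by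
  obtain ⟨A, hlen, hL, hnd, hA⟩ := h.exists_lists
  have hsum := sum_length_adjacency hnd hA
  have hflat := (length_flatten_adjacency hlen hL).trans hsum
  set m := H.edgeSet.ncard
  set K := (searchProgram N N).cost
  -- The products are expanded into monomials that `omega` can treat as atoms.
  have hWe : (N + 2 * t + 2) * (n + m + 1) =
      N * (n + 1) + 2 * t * n + 2 * n + 2 * m + 2 + (N * m + 2 * t * m + 2 * t) := by ring
  have hNn : N * (n + 1) = n * N + N := by ring
  have hfits : Fits n N L W := ⟨by omega, by omega, by omega, by omega⟩
  have hpre : Program.wp W (.seq (.op (.const 3 1)) (.seq (.op (.load 7 0 0))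
      (multiplyProgram (2 * t)))) (inputStore L) fun s' =>
      s'.reg 0 = n ∧ s'.reg 3 = 1 ∧ s'.reg 7 = 2 * m ∧ s'.reg 8 = 2 * t * n ∧
      (∀ r, r ≠ 0 → r ≠ 3 → r ≠ 7 → r ≠ 8 → s'.reg r = 0) ∧ s'.arr = (inputStore L).arr := by
    -- The last starting position is the total length of the lists, twice the number of edges.
    -- Reading this single cell keeps the edge count independent of `m` in time.
    have hload : (inputStore L).arr 0 n = 2 * m := by
      simp only [inputStore, if_true]
      rw [if_pos hlen.ge, List.take_of_length_le hlen.le, hflat]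
    have hreg0 : (inputStore L).reg 0 = n := by simp [inputStore, hlen]
    have hreg : ∀ r, r ≠ 0 → (inputStore L).reg r = 0 := fun r hr => by simp [inputStore, hr]
    simp only [Program.wp, Op.value, run_const_reg, run_const_arr, Nat.reduceEqDiff, if_false,
      hreg0, hload]
    refine ⟨by omega, by omega, Program.wp_mono (wp_multiplyProgram ?_) ?_⟩
    · simp only [run_load_reg, run_const_reg, Nat.reduceEqDiff, if_false, hreg0,
        hreg 8 (by simp)]
      omega
    · rintro s' ⟨h8, hreg', harr'⟩
      refine ⟨?_, ?_, ?_, ?_, ?_, ?_⟩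
      · rw [hreg' 0 (by simp)]; simp [hreg0]
      · rw [hreg' 3 (by simp)]; simp
      · rw [hreg' 7 (by simp)]; simp [hreg0, hload]
      · rw [h8]; simp [hreg0, hreg]
      · intro r h0 h3 h7 h8
        rw [hreg' r h8]
        simp [h7, h3, hreg r h0]
      · rw [harr']; simp
  obtain ⟨s₁, k₁, hex, hk₁, h0, h3, h7, h8, hreg, harr⟩ := hpre.runs
  simp only [Program.cost, cost_multiplyProgram] at hk₁
  have hbody : Runs W (.ite (.lt 8 7) (.op (.const 0 0)) (decomposeProgram N)) s₁
      ((3 * n + 2 * t * n + 1) * (K + 1) + 1 + (N * (n * 12 + 12) + 8) + 1) fun s' =>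
        (s'.reg 0 = 0 ∧ t * n < m) ∨
        ∃ (A : Fin n → List (Fin n)) (a : State n), a.Inv H A N ∧
          ((s'.reg 0 = 1 ∧ (∀ i < N, a.branch i ≠ []) ∧
              Outputs s' ((a.treePaths N).map (List.map Fin.val))) ∨
            (s'.reg 0 = 2 ∧ (∀ v, a.par v ≠ none) ∧
              Outputs s' (a.bags.map (List.map Fin.val)))) := by
    have htn : 2 * t * n = 2 * (t * n) := by ring
    refine Runs.ite (fun hb => ?_) (fun hb => ?_)
    · simp only [Test.holds, h7, h8] at hb
      refine ⟨_, 1, .op _ _ (Nat.zero_le _), by omega, .inl ⟨by simp, by omega⟩⟩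
    · simp only [Test.holds, h7, h8] at hb
      -- The candidates contribute `n`, the unvisited vertices `2 * n` and the unread list entries
      -- `2 * m ≤ 2 * t * n`.
      have hpot : (State.init n).potential A N ≤ 3 * n + 2 * t * n := by
        have h1 : (State.init n).unvisited.card ≤ n := by
          simpa using Finset.card_le_univ (State.init n).unvisited
        have h2 : (State.init n).active N = ∅ := by
          ext v
          simp [State.active, mem_heads, State.init]
        have h3 : ∑ v, ((A v).length - (State.init n).scan v) = 2 * m := by
          rw [← hsum]; rfl
        unfold State.potential
        rw [h2, h3]
        simp only [State.init, Finset.card_empty] at h1 ⊢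
        omega
      refine (runs_decomposeProgram hA hL hfits hN (by omega) (State.inv_init H A N)
        (represents_init hlen h0 h3 hreg harr)
        (hreg 6 (by simp) (by simp) (by simp) (by simp))).mono ?_
        fun s' ⟨a, ha, h⟩ => .inr ⟨A, a, ha, h⟩
      have := Nat.mul_le_mul_right (K + 1) (Nat.add_le_add_right hpot 1)
      simp only [K] at this ⊢
      omega
  obtain ⟨s₂, k₂, hex₂, hk₂, hpost⟩ := hbody
  refine ⟨s₂, k₁ + k₂, ?_, ?_, hpost⟩
  · cases hex with
    | seq h1 h2 =>
      cases h2 with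
      | seq h2 h3 =>
        -- The first three pieces were verified as one block, while `mainProgram` associates to the
        -- right.
        have := Exec.seq h1 (Exec.seq h2 (Exec.seq h3 hex₂))
        rwa [show ∀ a b c d : ℕ, a + (b + (c + d)) = a + (b + c) + d by intros; ring] at this
  · have e1 : (2 * t + 20 + (2 * t + 3) * (K + 1) + 12 * N) * (n + 1) =
        (3 * n + 2 * t * n + 1) * (K + 1) + N * (n * 12 + 12) + 2 * t + 20 +
        (2 * t * n + 20 * n + (2 * t + 2) * (K + 1)) := by ring
    omega

end

end PathwidthApprox

theorem corollary1 (t : ℕ) :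
    PathwidthApprox.guestOrder t ≤ 2 ^ (2 * t + 2) - 1 ∧
    ∃ (P : PathwidthApprox.Program) (C : ℕ),
      ∀ (n : ℕ) (H : SimpleGraph (Fin n)) (L : List (List ℕ)),
        PathwidthApprox.IsAdjacencyList H L →
        ∃ (s : PathwidthApprox.Store) (k : ℕ),
          PathwidthApprox.Exec (C * (n + H.edgeSet.ncard + 1)) P
            (PathwidthApprox.inputStore L) s k ∧
          k ≤ C * (n + 1) ∧
          ((s.reg 0 = 0 ∧ t < PathwidthApprox.pathwidth H ∧ t * n < H.edgeSet.ncard) ∨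
           (s.reg 0 = 1 ∧ t < PathwidthApprox.pathwidth H ∧
              ∃ (E : PathwidthApprox.HomeoEmbedding
                  (PathwidthApprox.binaryTree (PathwidthApprox.guestHeight t)) H)
                (out : List (List ℕ)),
                PathwidthApprox.Outputs s out ∧ PathwidthApprox.WritesEmbedding out E) ∨
           (s.reg 0 = 2 ∧
              ∃ (X : List (Finset (Fin n))) (out : List (List ℕ)),
                PathwidthApprox.IsPathDecomposition H X ∧
                PathwidthApprox.width X + 1 ≤ PathwidthApprox.guestOrder t ∧
                PathwidthApprox.Outputs s out ∧ PathwidthApprox.WritesBags out X)) := by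
  open PathwidthApprox in
  refine ⟨guestOrder_le t, mainProgram t (guestOrder t), 2 * t + 20 + (2 * t + 3) *
    ((searchProgram (guestOrder t) (guestOrder t)).cost + 1) + 12 * guestOrder t,
    fun n H L hL => ?_⟩
  obtain ⟨s, k, hex, hk, hpost⟩ := runs_mainProgram (t := t) hL (guestOrder_pos t)
    -- One constant serves for time and word size: the time constant dominates the factor
    -- `guestOrder t + 2 * t + 2` of the word bound.
    (Nat.mul_le_mul_right (n + H.edgeSet.ncard + 1) (show guestOrder t + 2 * t + 2 ≤
      2 * t + 20 + (2 * t + 3) * ((searchProgram (guestOrder t) (guestOrder t)).cost + 1) +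
        12 * guestOrder t by omega))
  refine ⟨s, k, hex, hk, ?_⟩
  rcases hpost with ⟨h0, hm⟩ | ⟨A, a, ha, ⟨h0, hfull, hout⟩ | ⟨h0, hvis, hout⟩⟩
  · exact .inl ⟨h0, lt_pathwidth_of_lt_ncard_edgeSet H hm, hm⟩
  · obtain ⟨E, hE⟩ := ha.exists_writesEmbedding hfull
    exact .inr (.inl ⟨h0, (lt_pathwidth_binaryTree_guestHeight t).trans_le (ha.pathwidth_le hfull),
      E, _, hout, hE⟩)
  · exact .inr (.inr ⟨h0, _, _, ha.isPathDecomposition hvis, ha.width_le (guestOrder_pos t), hout,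
      writesBags_map_val ha.bag_nodup⟩)
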